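/- **Theorem (2nd virial theorem).** Let $\mathcal H$ be a complex Hilbert space, $\Lambda\ge 1$ a selfadjoint operator with core $\mathcal D\subset\mathcal H$, and $A$ a selfadjoint operator with $\mathcal D\subset\mathcal D(A)$ such that $e^{itA}\mathcal D(\Lambda)\subset\mathcal D(\Lambda)$ for all $t\in\mathbb R$. Assume that $\mathcal D$ is a core for $\Lambda$ and $A$ jointly, i.e. that $\mathcal D$ is dense in $\mathcal D(\Lambda)\cap\mathcal D(A)$ in the norm $\|\Lambda\varphi\|+\|A\varphi\|$. Let $L,N,D,C_0,C_1,C_2,C_3$ be symmetric operators on $\mathcal D$, with $N\ge 0$ and $C_0=L$, such that for all $\varphi,\psi\in\mathcal D$ $$\langle\varphi,D\psi\rangle=i\{\langle L\varphi,N\psi\rangle-\langle N\varphi,L\psi\rangle\},\qquad \langle\varphi,C_n\psi\rangle=i\{\langle C_{n-1}\varphi,A\psi\rangle-\langle A\varphi,C_{n-1}\psi\rangle\},\quad n=1,2,3.$$ Assume that for each $X\in\{L,N,D,C_0,C_1,C_2,C_3\}$ the triple $(X,\Lambda,\mathcal D)$ satisfies the Glimm-Jaffe-Nelson condition: there is $k<\infty$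 with $\|X\psi\|\le k\|\Lambda\psi\|$ and $\pm i\{\langle X\psi,\Lambda\psi\rangle-\langle\Lambda\psi,X\psi\rangle\}\le k\langle\psi,\Lambda\psi\rangle$ for all $\psi\in\mathcal D$; these $X$ are then essentially selfadjoint on $\mathcal D$, and their selfadjoint closures are denoted by the same letters. Assume finally that there are $k,k',p\in[0,\infty)$ such that for all $\varphi\in\mathcal D$ and $t\in\mathbb R$ (in particular $\varphi\in\mathcal D(N^p)$) $$\|D\varphi\|\le k\|N^{1/2}\varphi\|,\qquad \|e^{itA}C_1e^{-itA}\varphi\|\le ke^{k'|t|}\|N^p\varphi\|,\qquad \|e^{itA}C_3e^{-itA}\varphi\|\le ke^{k'|t|}\|N^{1/2}\varphi\|.$$ Let $\psi$ be an eigenvector of $L$. Then: 1. If $A_0$ is a bounded operator on $\mathcal H$ with $\operatorname{Ran}A_0\subset\mathcal D(L)\cap\operatorname{Ran}P(N\le n_0)$ for some $n_0<\infty$, then $[L,A_0]=LA_0-A_0L$ is well defined in the strong sense on $\mathcal D(L)$. 2. There is a family $\{\psi_\alpha\}_{\alpha>0}\subset\mathcal D(L)\cap\mathcal D(C_1)$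 with $\psi_\alpha\to\psi$ and $\langle\psi_\alpha,C_1\psi_\alpha\rangle\to 0$ as $\alpha\to 0$. For every such family, and for every bounded selfadjoint $A_0$ as in 1, $$\lim_{\alpha\to0}\langle\psi_\alpha,(C_1+i[L,A_0])\psi_\alpha\rangle=0 .$$ -/

import Mathlib

open MeasureTheory Filter Topology Complex
open scoped InnerProductSpace ENNReal

noncomputable section

namespace Virial

variable {H : Type*} [NormedAddCommGroup H] [InnerProductSpace ℂ H] [CompleteSpace H]

/-! ### Operators on a common domain and their selfadjoint realisations -/

/-- The closure in `H` of an operator `X` given on the subspace `𝒟`. When `X` is symmetric on `𝒟`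
and satisfies the Glimm-Jaffe-Nelson condition it is essentially selfadjoint, and this is the
selfadjoint operator which it determines. -/
def saExt {𝒟 : Submodule ℂ H} (X : 𝒟 →ₗ[ℂ] H) : H →ₗ.[ℂ] H :=
  LinearPMap.closure ⟨𝒟, X⟩

/-- `X` is symmetric on its domain `𝒟`. -/
def SymmetricOn {𝒟 : Submodule ℂ H} (X : 𝒟 →ₗ[ℂ] H) : Prop :=
  ∀ φ ψ : 𝒟, ⟪X φ, (ψ : H)⟫_ℂ = ⟪(φ : H), X ψ⟫_ℂ

/-- `⟪φ, Z ψ⟫ = i (⟪X φ, Y ψ⟫ - ⟪Y φ, X ψ⟫)` for all `φ, ψ ∈ 𝒟`,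
that is, `Z = i[X, Y]` as forms on `𝒟`. -/
def IsFormCommutator {𝒟 : Submodule ℂ H} (Z X Y : 𝒟 →ₗ[ℂ] H) : Prop :=
  ∀ φ ψ : 𝒟, ⟪(φ : H), Z ψ⟫_ℂ = I * (⟪X φ, Y ψ⟫_ℂ - ⟪Y φ, X ψ⟫_ℂ)

/-- The restriction of `T` to a subspace `𝒟` of its domain. -/
def restrictTo (T : H →ₗ.[ℂ] H) {𝒟 : Submodule ℂ H} (h : 𝒟 ≤ T.domain) : 𝒟 →ₗ[ℂ] H :=
  T.toFun ∘ₗ Submodule.inclusion h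

/-- The Glimm-Jaffe-Nelson condition for the triple `(X, Y, 𝒟)`, where `Y` enters through its
restriction to `𝒟`. The number inside the absolute value is real. -/
def GJN {𝒟 : Submodule ℂ H} (X Y : 𝒟 →ₗ[ℂ] H) : Prop :=
  ∃ k : ℝ, ∀ ψ : 𝒟, ‖X ψ‖ ≤ k * ‖Y ψ‖ ∧
    |(I * (⟪X ψ, Y ψ⟫_ℂ - ⟪Y ψ, X ψ⟫_ℂ)).re| ≤ k * (⟪(ψ : H), Y ψ⟫_ℂ).re

/-! ### Unitary groups -/

/-- `U t = e^{itA}` for all `t`: `U` is a strongly continuous one-parameter unitary group, and `A`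
is its full infinitesimal generator. -/
structure IsUnitaryGroupOf (U : ℝ → unitary (H →L[ℂ] H)) (A : H →ₗ.[ℂ] H) : Prop where
  map_zero : U 0 = 1
  map_add : ∀ s t, U (s + t) = U s * U t
  continuous : ∀ φ : H, Continuous fun t => (U t : H →L[ℂ] H) φ
  generator : ∀ φ y : H, (φ, y) ∈ A.graph ↔
    HasDerivAt (fun t => (U t : H →L[ℂ] H) φ) (I • y) 0

/-! ### Spectral measures -/

/-- Projection-valued measures on the Borel sets of `ℝ`. -/
structure ProjMeasure (H : Type*) [NormedAddCommGroup H] [InnerProductSpace ℂ H]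
    [CompleteSpace H] where
  proj : Set ℝ → H →L[ℂ] H
  isStarProjection : ∀ s, MeasurableSet s → IsStarProjection (proj s)
  univ : proj Set.univ = 1
  inter : ∀ s t, MeasurableSet s → MeasurableSet t → proj (s ∩ t) = proj s * proj t
  hasSum : ∀ f : ℕ → Set ℝ, (∀ n, MeasurableSet (f n)) → Pairwise (Function.onFun Disjoint f) →
    ∀ φ : H, HasSum (fun n => proj (f n) φ) (proj (⋃ n, f n) φ)

namespace ProjMeasure

variable (E : ProjMeasure H)

lemma proj_empty (φ : H) : E.proj ∅ φ = 0 := by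
  have h := E.hasSum (fun _ => ∅) (fun _ => MeasurableSet.empty)
    (fun _ _ _ => disjoint_bot_left) φ
  have h2 := h.summable.tendsto_atTop_zero
  exact tendsto_nhds_unique tendsto_const_nhds h2

lemma re_inner_proj_nonneg {s : Set ℝ} (hs : MeasurableSet s) (φ : H) :
    0 ≤ (⟪φ, E.proj s φ⟫_ℂ).re := by
  have hp := E.isStarProjection s hs
  have h1 : E.proj s φ = E.proj s (E.proj s φ) := by
    conv_lhs => rw [← hp.isIdempotentElem.eq]
    rfl
  have h2 := ContinuousLinearMap.adjoint_inner_left (E.proj s) (E.proj s φ) φ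
  rw [← ContinuousLinearMap.star_eq_adjoint, hp.isSelfAdjoint.star_eq] at h2
  rw [h1, ← h2]
  exact inner_self_nonneg (𝕜 := ℂ) (x := E.proj s φ)

/-- The scalar measure `s ↦ ⟪φ, E(s) φ⟫`. -/
def scalar (φ : H) : Measure ℝ :=
  Measure.ofMeasurable (fun s _ => ENNReal.ofReal (⟪φ, E.proj s φ⟫_ℂ).re)
    (by simp [E.proj_empty])
    (by
      intro f hf hd
      have h := (E.hasSum f hf hd φ).mapL (innerSL ℂ φ)
      have h' := Complex.reCLM.hasSum h
      simp only [Complex.reCLM_apply, innerSL_apply_apply] at h'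
      have h0 : ∀ n, 0 ≤ (⟪φ, E.proj (f n) φ⟫_ℂ).re :=
        fun n => E.re_inner_proj_nonneg (hf n) φ
      rw [← h'.tsum_eq, ENNReal.ofReal_tsum_of_nonneg h0 h'.summable])

/-- `E` is the spectral measure of the selfadjoint operator `T`, that is, `T = ∫ x dE(x)`:
`φ` lies in the domain of `T` iff `∫ x² d⟪φ, E φ⟫ < ∞`, and then `⟪φ, T φ⟫ = ∫ x d⟪φ, E φ⟫`. -/
def IsSpectralMeasureOf (T : H →ₗ.[ℂ] H) : Prop :=
  (∀ φ : H, φ ∈ T.domain ↔ Integrable (fun x : ℝ => x ^ 2) (E.scalar φ)) ∧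
  ∀ φ : T.domain, ⟪(φ : H), T φ⟫_ℂ = ((∫ x : ℝ, x ∂(E.scalar (φ : H)) : ℝ) : ℂ)

/-- `φ` belongs to the domain of `T ^ s`, for the nonnegative selfadjoint operator `T` with spectral
measure `E`. -/
def MemPowDomain (s : ℝ) (φ : H) : Prop :=
  Integrable (fun x : ℝ => (x ^ s) ^ 2) (E.scalar φ)

/-- The norm `‖T ^ s φ‖`, for the nonnegative selfadjoint operator `T` with spectral
measure `E`. -/
def powNorm (s : ℝ) (φ : H) : ℝ :=
  Real.sqrt (∫ x : ℝ, (x ^ s) ^ 2 ∂(E.scalar φ))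

end ProjMeasure

/-! ### The setting of the virial theorems -/

/-- The abstract setting. `Λ` and `A` are the given selfadjoint operators, `U t = e^{itA}`, the
operators `L, N, D, C n` are given on the common core `𝒟`, and `E` is the spectral measure of the
selfadjoint operator determined by `N`. -/
structure Setting (𝒟 : Submodule ℂ H) (Λ A : H →ₗ.[ℂ] H) (U : ℝ → unitary (H →L[ℂ] H))
    (L N D : 𝒟 →ₗ[ℂ] H) (C : Fin 4 → 𝒟 →ₗ[ℂ] H) (E : ProjMeasure H) : Prop where
  Λ_selfAdjoint : IsSelfAdjoint Λ
  one_le_Λ : ∀ φ : Λ.domain, ‖(φ : H)‖ ^ 2 ≤ (⟪(φ : H), Λ φ⟫_ℂ).re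
  Λ_core : Λ.HasCore 𝒟
  A_selfAdjoint : IsSelfAdjoint A
  U_exp : IsUnitaryGroupOf U A
  le_A : 𝒟 ≤ A.domain
  U_invariant : ∀ t, ∀ φ ∈ Λ.domain, (U t : H →L[ℂ] H) φ ∈ Λ.domain
  /-- `𝒟` is dense in `D(Λ) ∩ D(A)` in the norm `‖Λ φ‖ + ‖A φ‖`. -/
  joint_core : ∀ (φ : H) (hΛ : φ ∈ Λ.domain) (hA : φ ∈ A.domain) (ε : ℝ), 0 < ε →
    ∃ χ : 𝒟, ‖Λ ⟨φ, hΛ⟩ - restrictTo Λ Λ_core.le_domain χ‖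
      + ‖A ⟨φ, hA⟩ - restrictTo A le_A χ‖ < ε
  L_symm : SymmetricOn L
  N_symm : SymmetricOn N
  D_symm : SymmetricOn D
  C_symm : ∀ n, SymmetricOn (C n)
  D_eq : IsFormCommutator D L N
  C_zero : C 0 = L
  C_succ : ∀ n : Fin 3, IsFormCommutator (C n.succ) (C n.castSucc) (restrictTo A le_A)
  L_gjn : GJN L (restrictTo Λ Λ_core.le_domain)
  N_gjn : GJN N (restrictTo Λ Λ_core.le_domain)
  D_gjn : GJN D (restrictTo Λ Λ_core.le_domain)
  C_gjn : ∀ n, GJN (C n) (restrictTo Λ Λ_core.le_domain)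
  N_nonneg : ∀ φ : 𝒟, 0 ≤ (⟪(φ : H), N φ⟫_ℂ).re
  E_spectral : E.IsSpectralMeasureOf (saExt N)

/-- `X ≤ k T ^ s` in the sense of Kato on `𝒟`, where `T ≥ 0` has spectral measure `E`. -/
def KatoBound {𝒟 : Submodule ℂ H} (E : ProjMeasure H) (s k : ℝ) (X : 𝒟 →ₗ[ℂ] H) : Prop :=
  ∀ φ : 𝒟, E.MemPowDomain s (φ : H) ∧ ‖X φ‖ ≤ k * E.powNorm s (φ : H)

/-- `e^{itA} X e^{-itA} ≤ k e^{k'|t|} T ^ s` in the sense of Kato on `𝒟`, for all real `t`, where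
`U t = e^{itA}`, `X` is taken as a closed operator, and `T ≥ 0` has spectral measure `E`. -/
def ConjKatoBound {𝒟 : Submodule ℂ H} (E : ProjMeasure H) (U : ℝ → unitary (H →L[ℂ] H))
    (s k k' : ℝ) (X : 𝒟 →ₗ[ℂ] H) : Prop :=
  ∀ (t : ℝ) (φ : 𝒟), E.MemPowDomain s (φ : H) ∧
    ∀ h : (U (-t) : H →L[ℂ] H) φ ∈ (saExt X).domain,
      ‖(U t : H →L[ℂ] H) (saExt X ⟨(U (-t) : H →L[ℂ] H) φ, h⟩)‖
        ≤ k * Real.exp (k' * |t|) * E.powNorm s (φ : H)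

/-- The relative bounds assumed in the virial theorems. -/
def RelativeBounds {𝒟 : Submodule ℂ H} (U : ℝ → unitary (H →L[ℂ] H)) (E : ProjMeasure H)
    (D : 𝒟 →ₗ[ℂ] H) (C : Fin 4 → 𝒟 →ₗ[ℂ] H) : Prop :=
  ∃ k k' p : ℝ, 0 ≤ k ∧ 0 ≤ k' ∧ 0 ≤ p ∧
    KatoBound E (1 / 2) k D ∧
    ConjKatoBound E U p k k' (C 1) ∧
    ConjKatoBound E U (1 / 2) k k' (C 3)

/-- `(ψ_α)`, `α > 0`, is a family of approximate eigenvectors as in the first virial theorem: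
`ψ_α ∈ D(L) ∩ D(C₁)`, `ψ_α → ψ` and `⟪ψ_α, C₁ ψ_α⟫ → 0` as `α → 0`. -/
structure IsVirialFamily (L C₁ : H →ₗ.[ℂ] H) (ψ : H) (ψα : Set.Ioi (0 : ℝ) → H) : Prop where
  mem_L : ∀ α, ψα α ∈ L.domain
  mem_C₁ : ∀ α, ψα α ∈ C₁.domain
  tendsto : Tendsto ψα (comap Subtype.val (𝓝 0)) (𝓝 ψ)
  virial : Tendsto (fun α => ⟪ψα α, C₁ ⟨ψα α, mem_C₁ α⟩⟫_ℂ) (comap Subtype.val (𝓝 0)) (𝓝 0)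

/-- The commutator `[T, B] = T B - B T` of an operator `T` with an everywhere defined operator `B`,
in the strong sense: its domain consists of all `φ ∈ D(T)` with `B φ ∈ D(T)`. -/
def commutator (T : H →ₗ.[ℂ] H) (B : H →L[ℂ] H) : H →ₗ.[ℂ] H where
  domain := T.domain ⊓ T.domain.comap (B : H →ₗ[ℂ] H)
  toFun :=
    { toFun := fun φ => T ⟨B φ, φ.2.2⟩ - B (T ⟨φ, φ.2.1⟩)
      map_add' := by
        intro x y
        have h1 : (⟨B ((x + y : _) : H), (x + y).2.2⟩ : T.domain)
            = ⟨B x, x.2.2⟩ + ⟨B y, y.2.2⟩ := by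
          ext; simp
        have h2 : (⟨((x + y : _) : H), (x + y).2.1⟩ : T.domain)
            = ⟨x, x.2.1⟩ + ⟨y, y.2.1⟩ := by
          ext; simp
        rw [h1, h2, T.map_add, T.map_add, map_add]
        abel
      map_smul' := by
        intro c x
        have h1 : (⟨B ((c • x : _) : H), (c • x).2.2⟩ : T.domain) = c • ⟨B x, x.2.2⟩ := by
          ext; simp
        have h2 : (⟨((c • x : _) : H), (c • x).2.1⟩ : T.domain) = c • ⟨x, x.2.1⟩ := by
          ext; simp
        rw [h1, h2, T.map_smul, T.map_smul, map_smul, RingHom.id_apply, smul_sub] }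

end Virial

end

set_option linter.unusedSectionVars false

noncomputable section

namespace Virial

variable {H : Type*} [NormedAddCommGroup H] [InnerProductSpace ℂ H] [CompleteSpace H]

/-! ### Regularisation by the resolvent of a positive operator -/

/-! Formally `C₁ = i[L, A]`, so its expectation in an eigenvector of `L` vanishes; but `ψ` need lie
neither in `D(A)` nor in `D(C₁)`. It is therefore approximated in two stages, with all operators
made bounded: with `S = Λ⁻¹`, a vector of `D(Λ)` is `S z`, and `X z`, `T z` stand for `X` and
`Λ^{1/2}` applied to `S z`. The recurring condition `∀ z, ⟪X z, w⟫ = ⟪S z, y⟫` says that `X* w = y`.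
The Glimm-Jaffe-Nelson condition makes `(1 + εΛ)⁻¹ = S (S + ε)⁻¹` a harmless regularisation.

Stage 1 (`exists_regular_approx_eigenvector`). Apply `R = (1 + iνN)⁻¹` to vectors near `ψ` in the
graph of `L`. Then `N` costs `O(1/ν)`, while `[L, R] = -ν R D R` as a form; since `D` is bounded by
`N^{1/2}`, the error in the eigenvalue equation is only `O(√ν)`.

Stage 2 (`exists_average`). Average the resulting `φ` over `e^{itA}`, `|t| ≤ α`. The functions
`γₙ(r) = ⟨e^{i(u+r)A} φ, Cₙ e^{irA} φ⟩` satisfy `γₙ' = γₙ₊₁`, so after symmetrising, `γ₁` can be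
replaced by a difference quotient of `γ₀` with an error governed by `C₃`, of size `α² ν^{-1/2}`. The
quotient sees only `(L - e) φ`, and its weights `1/(j - k)` form a discrete Hilbert transform,
bounded without logarithmic loss (`norm_sum_unitary_zpow_div_le`); this leaves `√ν / α`. With `ν =
β⁶` and `α = β²` both errors are `O(β)`.

For a bounded `A₀` mapping into `D(L)`, the operator `L A₀` is bounded by the closed graph theorem.
Hence the expectation of `[L, A₀]` is continuous in the vector, and it vanishes at `ψ`
(`tendsto_inner_commutator`). -/

/-- `S` is the inverse of an operator `Λ ≥ 1`, and `T` its square root. -/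
structure IsScale (S T : H →L[ℂ] H) : Prop where
  symm : ∀ x y, ⟪T x, y⟫_ℂ = ⟪x, T y⟫_ℂ
  sq : ∀ x, T (T x) = S x
  norm_le : ∀ x, ‖S x‖ ≤ ‖T x‖
  dense : DenseRange S

namespace IsScale

variable {S T : H →L[ℂ] H} (h : IsScale S T)
include h

lemma symm_sq (x y : H) : ⟪S x, y⟫_ℂ = ⟪x, S y⟫_ℂ := by
  rw [← h.sq, ← h.sq, h.symm, h.symm]

lemma inner_left (x y : H) : ⟪S x, y⟫_ℂ = ⟪T x, T y⟫_ℂ := by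
  rw [← h.sq, h.symm]

lemma inner_right (x y : H) : ⟪x, S y⟫_ℂ = ⟪T x, T y⟫_ℂ := by
  rw [← h.sq, h.symm]

lemma inner_self_left (x : H) : ⟪S x, x⟫_ℂ = ((‖T x‖ ^ 2 : ℝ) : ℂ) := by
  rw [h.inner_left, inner_self_eq_norm_sq_to_K]; norm_cast

lemma inner_self_right (x : H) : ⟪x, S x⟫_ℂ = ((‖T x‖ ^ 2 : ℝ) : ℂ) := by
  rw [h.inner_right, inner_self_eq_norm_sq_to_K]; norm_cast

lemma eq_zero_of_sqrt {x : H} (hx : ‖T x‖ = 0) : x = 0 := by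
  have h1 : S x = 0 := by
    have := h.norm_le x
    rw [hx] at this
    exact norm_le_zero_iff.mp this
  refine h.dense.eq_zero_of_inner_left (𝕜 := ℂ) ?_
  intro y
  rw [← h.symm_sq, h1, inner_zero_left]

lemma injective : Function.Injective S := by
  rw [injective_iff_map_eq_zero]
  intro x hx
  refine h.dense.eq_zero_of_inner_left (𝕜 := ℂ) ?_
  intro y
  rw [← h.symm_sq, hx, inner_zero_left]

end IsScale

/-- The operator `(S + ε)⁻¹`. -/
def reg (S : H →L[ℂ] H) (ε : ℝ) : H →L[ℂ] H := Ring.inverse (S + (ε : ℂ) • 1)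

namespace IsScale

variable {S T : H →L[ℂ] H} (h : IsScale S T) {ε : ℝ} (hε : 0 < ε)
include h hε

lemma isUnit_add : IsUnit (S + (ε : ℂ) • 1) := by
  refine ContinuousLinearMap.isUnit_of_forall_le_norm_inner_map _ (c := ⟨ε, hε.le⟩) hε fun x => ?_
  have h1 : ⟪(S + (ε : ℂ) • (1 : H →L[ℂ] H)) x, x⟫_ℂ = ((‖T x‖ ^ 2 + ε * ‖x‖ ^ 2 : ℝ) : ℂ) := by
    simp [h.inner_self_left, inner_self_eq_norm_sq_to_K]
  rw [h1, Complex.norm_real, Real.norm_of_nonneg (by positivity)]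
  change ‖x‖ ^ 2 * ε ≤ _
  nlinarith [sq_nonneg ‖T x‖]

lemma reg_right (x : H) : S (reg S ε x) + (ε : ℂ) • reg S ε x = x := by
  have := Ring.mul_inverse_cancel _ (h.isUnit_add hε)
  simpa [reg] using congrArg (fun F : H →L[ℂ] H => F x) this

lemma reg_left (x : H) : reg S ε (S x) + (ε : ℂ) • reg S ε x = x := by
  have := Ring.inverse_mul_cancel _ (h.isUnit_add hε)
  simpa [reg] using congrArg (fun F : H →L[ℂ] H => F x) this

lemma reg_comm (x : H) : reg S ε (S x) = S (reg S ε x) := by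
  have h1 := h.reg_right hε x
  have h2 := h.reg_left hε x
  exact add_right_cancel (h2.trans h1.symm)

lemma reg_symm (x y : H) : ⟪reg S ε x, y⟫_ℂ = ⟪x, reg S ε y⟫_ℂ := by
  conv_lhs => rw [← h.reg_right hε y]
  conv_rhs => rw [← h.reg_right hε x]
  simp [h.symm_sq]

/-- Expand `x = S P x + ε P x` with `P = (S + ε)⁻¹`. Positivity of `S` makes the cross term
nonnegative, so each summand alone is bounded by the left side. -/
lemma norm_sq_eq (x : H) :
    ‖x‖ ^ 2 = ‖S (reg S ε x)‖ ^ 2 + ε ^ 2 * ‖reg S ε x‖ ^ 2 + 2 * ε * ‖T (reg S ε x)‖ ^ 2 := by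
  conv_lhs => rw [← h.reg_right hε x]
  rw [norm_add_sq (𝕜 := ℂ), norm_smul, inner_smul_right, h.inner_self_left]
  simp only [Complex.norm_real, Real.norm_of_nonneg hε.le]
  rw [← Complex.ofReal_mul]
  simp only [RCLike.re_to_complex, Complex.ofReal_re]
  ring

lemma sqrt_norm_sq_eq (x : H) :
    ‖T x‖ ^ 2 = ‖T (S (reg S ε x))‖ ^ 2 + ε ^ 2 * ‖T (reg S ε x)‖ ^ 2
      + 2 * ε * ‖S (reg S ε x)‖ ^ 2 := by
  conv_lhs => rw [← h.reg_right hε x]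
  rw [map_add, map_smul, norm_add_sq (𝕜 := ℂ), norm_smul, inner_smul_right, ← h.inner_right,
    inner_self_eq_norm_sq_to_K]
  simp only [Complex.norm_real, Real.norm_of_nonneg hε.le]
  have : ((‖S (reg S ε x)‖ : ℂ)) ^ 2 = ((‖S (reg S ε x)‖ ^ 2 : ℝ) : ℂ) := by norm_cast
  simp only [RCLike.re_to_complex, RCLike.ofReal_eq_complex_ofReal] at *
  rw [this, ← Complex.ofReal_mul, Complex.ofReal_re]
  ring

lemma norm_sq_reg_le (x : H) : ‖S (reg S ε x)‖ ≤ ‖x‖ := by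
  have := h.norm_sq_eq hε x
  refine le_of_sq_le_sq ?_ (norm_nonneg _)
  nlinarith [sq_nonneg (ε * ‖reg S ε x‖), mul_nonneg hε.le (sq_nonneg ‖T (reg S ε x)‖)]

lemma mul_sqrt_reg_sq_le (x : H) : ε * ‖T (reg S ε x)‖ ^ 2 ≤ ‖x‖ ^ 2 := by
  have := h.norm_sq_eq hε x
  nlinarith [sq_nonneg ‖S (reg S ε x)‖, sq_nonneg (ε * ‖reg S ε x‖),
    mul_nonneg hε.le (sq_nonneg ‖T (reg S ε x)‖)]

lemma mul_sqrt_reg_le (x : H) : ε * ‖T (reg S ε x)‖ ≤ ‖T x‖ := by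
  have := h.sqrt_norm_sq_eq hε x
  refine le_of_sq_le_sq ?_ (norm_nonneg _)
  nlinarith [sq_nonneg ‖T (S (reg S ε x))‖, mul_nonneg hε.le (sq_nonneg ‖S (reg S ε x)‖)]

lemma sqrt_reg_le (x : H) : ‖T (S (reg S ε x))‖ ≤ ‖T x‖ := by
  have := h.sqrt_norm_sq_eq hε x
  refine le_of_sq_le_sq ?_ (norm_nonneg _)
  nlinarith [sq_nonneg (ε * ‖T (reg S ε x)‖), mul_nonneg hε.le (sq_nonneg ‖S (reg S ε x)‖)]

end IsScale

namespace IsScale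

variable {S T : H →L[ℂ] H} (h : IsScale S T)
include h

/-- These operators are contractions, and on the dense range of `S` they differ from the identity by
`O(ε)`. -/
lemma tendsto_reg (x : H) : Tendsto (fun ε => S (reg S ε x)) (𝓝[>] 0) (𝓝 x) := by
  rw [Metric.tendsto_nhds]
  intro η hη
  obtain ⟨y, hy⟩ := h.dense.exists_dist_lt x (show 0 < η / 3 by positivity)
  have h1 : ∀ᶠ ε : ℝ in 𝓝[>] 0, ε * ‖y‖ < η / 3 := by
    have : Tendsto (fun ε : ℝ => ε * ‖y‖) (𝓝[>] 0) (𝓝 (0 * ‖y‖)) :=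
      (tendsto_id.mono_left nhdsWithin_le_nhds).mul_const _
    rw [zero_mul] at this
    exact this.eventually_lt_const (by positivity)
  filter_upwards [h1, self_mem_nhdsWithin] with ε hε1 (hε : 0 < ε)
  have e1 : S (reg S ε x) - x = S (reg S ε (x - S y)) - (ε : ℂ) • S (reg S ε y) - (x - S y) := by
    have := h.reg_right hε (S y)
    rw [h.reg_comm hε] at this
    rw [map_sub, map_sub, h.reg_comm hε]
    rw [← this]
    abel
  rw [dist_eq_norm, e1]
  rw [dist_eq_norm] at hy
  calc _ ≤ ‖S (reg S ε (x - S y))‖ + ‖(ε : ℂ) • S (reg S ε y)‖ + ‖x - S y‖ := by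
        refine (norm_sub_le _ _).trans ?_
        gcongr
        exact norm_sub_le _ _
    _ ≤ ‖x - S y‖ + ε * ‖y‖ + ‖x - S y‖ := by
        gcongr
        · exact h.norm_sq_reg_le hε _
        · rw [norm_smul, Complex.norm_real, Real.norm_of_nonneg hε.le]
          gcongr
          exact h.norm_sq_reg_le hε _
    _ < η := by linarith

/-- The quantity equals `⟪S P x, x - S P x⟫`, whose second entry tends to zero. It gives the `o(1)`
in every later commutator error. -/
lemma tendsto_mul_sqrt_reg_sq (x : H) :
    Tendsto (fun ε => ε * ‖T (reg S ε x)‖ ^ 2) (𝓝[>] 0) (𝓝 0) := by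
  have h1 : Tendsto (fun ε => ‖x‖ * ‖x - S (reg S ε x)‖) (𝓝[>] 0) (𝓝 0) := by
    have := ((tendsto_const_nhds (x := x)).sub (h.tendsto_reg x)).norm.const_mul ‖x‖
    simpa using this
  refine squeeze_zero' ?_ ?_ h1
  · filter_upwards [self_mem_nhdsWithin] with ε (hε : 0 < ε)
    positivity
  · filter_upwards [self_mem_nhdsWithin] with ε (hε : 0 < ε)
    have e1 : x - S (reg S ε x) = (ε : ℂ) • reg S ε x := by
      conv_lhs => enter [1]; rw [← h.reg_right hε x]
      abel
    have e2 : ((ε * ‖T (reg S ε x)‖ ^ 2 : ℝ) : ℂ) = ⟪S (reg S ε x), x - S (reg S ε x)⟫_ℂ := by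
      rw [e1, inner_smul_right, h.inner_self_left]
      push_cast; ring
    calc ε * ‖T (reg S ε x)‖ ^ 2 = ‖((ε * ‖T (reg S ε x)‖ ^ 2 : ℝ) : ℂ)‖ := by
          rw [Complex.norm_real, Real.norm_of_nonneg (by positivity)]
      _ ≤ ‖S (reg S ε x)‖ * ‖x - S (reg S ε x)‖ := by
          rw [e2]; exact norm_inner_le_norm _ _
      _ ≤ _ := by gcongr; exact h.norm_sq_reg_le hε x

end IsScale

/-- The Glimm-Jaffe-Nelson condition for a symmetric operator on the range of `S`, given by the
bounded operator `X` (the operator composed with `S`). -/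
structure GJNOp (S T X : H →L[ℂ] H) (k : ℝ) : Prop where
  nonneg : 0 ≤ k
  symm : ∀ z y, ⟪X z, S y⟫_ℂ = ⟪S z, X y⟫_ℂ
  comm : ∀ z, |(⟪X z, z⟫_ℂ).im| ≤ k / 2 * ‖T z‖ ^ 2

/-! ### The commutator with `Λ` as a bounded form on `D(Λ^{1/2})` -/

namespace GJNOp

variable {S T X : H →L[ℂ] H} {k : ℝ}

/-- Polarise the quadratic bound at `z + y` and `z - y`; the parallelogram law collects the right
side. -/
lemma im_comm_le (hX : GJNOp S T X k) (z y : H) :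
    |(⟪z, X y⟫_ℂ - ⟪X z, y⟫_ℂ).im| ≤ k / 2 * (‖T z‖ ^ 2 + ‖T y‖ ^ 2) := by
  have h1 := abs_le.mp (hX.comm (z + y))
  have h2 := abs_le.mp (hX.comm (z - y))
  have h3 : ‖T (z + y)‖ ^ 2 + ‖T (z - y)‖ ^ 2 = 2 * (‖T z‖ ^ 2 + ‖T y‖ ^ 2) := by
    have := parallelogram_law_with_norm ℂ (T z) (T y)
    rw [map_add, map_sub]
    nlinarith
  have e1 : (⟪X (z + y), z + y⟫_ℂ).im - (⟪X (z - y), z - y⟫_ℂ).im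
      = -2 * (⟪z, X y⟫_ℂ - ⟪X z, y⟫_ℂ).im := by
    have := congrArg Complex.im (inner_conj_symm (𝕜 := ℂ) z (X y))
    simp only [map_add, map_sub, inner_add_left, inner_add_right, inner_sub_left, inner_sub_right,
      Complex.add_im, Complex.sub_im, Complex.conj_im] at this ⊢
    linarith
  have h4 := congrArg (k / 2 * ·) h3
  simp only [mul_add] at h4
  rw [abs_le]
  constructor <;> linarith

lemma norm_comm_le' (hX : GJNOp S T X k) (z y : H) :
    ‖⟪z, X y⟫_ℂ - ⟪X z, y⟫_ℂ‖ ≤ k / 2 * (‖T z‖ ^ 2 + ‖T y‖ ^ 2) := by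
  set b := ⟪z, X y⟫_ℂ - ⟪X z, y⟫_ℂ with hb
  rcases eq_or_ne b 0 with h0 | h0
  · rw [h0, norm_zero]
    have := hX.nonneg
    positivity
  have hn : ‖b‖ ≠ 0 := norm_ne_zero_iff.mpr h0
  have hn' : (‖b‖ : ℂ) ≠ 0 := by exact_mod_cast hn
  -- Rotating `y` by this phase makes the form purely imaginary, so the bound on the imaginary part
  -- controls the modulus.
  set c : ℂ := I * (starRingEnd ℂ b) / ‖b‖ with hc
  have hcn : ‖c‖ = 1 := by
    rw [hc, norm_div, norm_mul, RCLike.norm_conj, Complex.norm_I, Complex.norm_real, norm_norm,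
      one_mul, div_self hn]
  have hcb : c * b = I * ‖b‖ := by
    rw [hc, div_mul_eq_mul_div, mul_assoc, mul_comm (starRingEnd ℂ b), Complex.mul_conj,
      Complex.normSq_eq_norm_sq]
    push_cast
    field_simp
  have := hX.im_comm_le z (c • y)
  rw [map_smul, map_smul, inner_smul_right, inner_smul_right, ← mul_sub, ← hb, hcb, norm_smul,
    hcn, one_mul] at this
  simpa using this

/-- Rescaling `z` by `‖T y‖` and `y` by `‖T z‖` balances the two squares and turns their sum into a
product. -/
lemma norm_comm_le (hX : GJNOp S T X k) (h : IsScale S T) (z y : H) :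
    ‖⟪z, X y⟫_ℂ - ⟪X z, y⟫_ℂ‖ ≤ k * ‖T z‖ * ‖T y‖ := by
  by_cases hz : ‖T z‖ = 0
  · simp [h.eq_zero_of_sqrt hz]
  by_cases hy : ‖T y‖ = 0
  · simp [h.eq_zero_of_sqrt hy]
  have := hX.norm_comm_le' ((‖T y‖ : ℂ) • z) ((‖T z‖ : ℂ) • y)
  simp only [map_smul, inner_smul_right, inner_smul_left, Complex.conj_ofReal, norm_smul,
    Complex.norm_real, norm_norm] at this
  have e : (‖T z‖ : ℂ) * (‖T y‖ * ⟪z, X y⟫_ℂ) - ‖T z‖ * (‖T y‖ * ⟪X z, y⟫_ℂ)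
      = ((‖T z‖ * ‖T y‖ : ℝ) : ℂ) * (⟪z, X y⟫_ℂ - ⟪X z, y⟫_ℂ) := by
    push_cast; ring
  rw [e, norm_mul, Complex.norm_real, Real.norm_of_nonneg (by positivity)] at this
  have hp : 0 < ‖T z‖ * ‖T y‖ := by positivity
  refine le_of_mul_le_mul_left (this.trans (le_of_eq ?_)) hp
  ring

end GJNOp
/-! ### Commutators with the regularisation -/

namespace GJNOp

variable {S T X : H →L[ℂ] H} {k : ℝ}

/-- Splitting `x` and `w` by `v = S P v + ε P v` leaves the defect of `X* w = y`, tested on `S P x`,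
plus `ε` times the commutator form of `X` and `Λ` at `P x`, `P w`. The defect `δ` is kept so that
approximate eigenvalue equations are covered. -/
lemma norm_inner_reg_sub_le (hX : GJNOp S T X k) (h : IsScale S T) {w y : H} {δ : ℝ}
    (hwy : ∀ z, ‖⟪X z, w⟫_ℂ - ⟪S z, y⟫_ℂ‖ ≤ δ * ‖S z‖) {ε : ℝ} (hε : 0 < ε) (x : H) :
    ‖⟪x, X (reg S ε w) - S (reg S ε y)⟫_ℂ‖
      ≤ δ * ‖S (reg S ε x)‖ + ε * (k * ‖T (reg S ε x)‖ * ‖T (reg S ε w)‖) := by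
  set P := reg S ε
  have e1 : ⟪x, X (P w)⟫_ℂ = ⟪X (P x), S (P w)⟫_ℂ + ε * ⟪P x, X (P w)⟫_ℂ := by
    conv_lhs => rw [← h.reg_right hε x]
    rw [inner_add_left, inner_smul_left, Complex.conj_ofReal, hX.symm]
  have e2 : ⟪x, S (P y)⟫_ℂ = ⟪S (P x), y⟫_ℂ := by
    rw [← h.symm_sq, ← h.reg_symm hε, h.reg_comm hε]
  have e3 : ⟪X (P x), w⟫_ℂ = ⟪X (P x), S (P w)⟫_ℂ + ε * ⟪X (P x), P w⟫_ℂ := by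
    conv_lhs => rw [← h.reg_right hε w]
    rw [inner_add_right, inner_smul_right]
  have e4 : ⟪x, X (P w) - S (P y)⟫_ℂ = (⟪X (P x), w⟫_ℂ - ⟪S (P x), y⟫_ℂ)
      + ε * (⟪P x, X (P w)⟫_ℂ - ⟪X (P x), P w⟫_ℂ) := by
    rw [inner_sub_right, e1, e2, e3]; ring
  rw [e4]
  refine (norm_add_le _ _).trans (add_le_add (hwy _) ?_)
  rw [norm_mul, Complex.norm_real, Real.norm_of_nonneg hε.le]
  gcongr
  exact hX.norm_comm_le h _ _

/-- Test the form estimate on the vector itself; one factor `√ε` is absorbed by `√ε ‖T P F‖ ≤ ‖F‖`,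
the other stays with `w`. -/
lemma norm_reg_sub_le (hX : GJNOp S T X k) (h : IsScale S T) {w y : H} {δ : ℝ} (hδ : 0 ≤ δ)
    (hwy : ∀ z, ‖⟪X z, w⟫_ℂ - ⟪S z, y⟫_ℂ‖ ≤ δ * ‖S z‖) {ε : ℝ} (hε : 0 < ε) :
    ‖X (reg S ε w) - S (reg S ε y)‖ ≤ δ + k * √(ε * ‖T (reg S ε w)‖ ^ 2) := by
  set F := X (reg S ε w) - S (reg S ε y) with hF
  have h1 := hX.norm_inner_reg_sub_le h hwy hε F
  rw [← hF, inner_self_eq_norm_sq_to_K] at h1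
  have h2 : √ε * ‖T (reg S ε F)‖ ≤ ‖F‖ := by
    refine le_of_sq_le_sq ?_ (norm_nonneg _)
    rw [mul_pow, Real.sq_sqrt hε.le]
    exact h.mul_sqrt_reg_sq_le hε F
  have h3 : √(ε * ‖T (reg S ε w)‖ ^ 2) = √ε * ‖T (reg S ε w)‖ := by
    rw [Real.sqrt_mul hε.le, Real.sqrt_sq (norm_nonneg _)]
  have h4 : ε * (k * ‖T (reg S ε F)‖ * ‖T (reg S ε w)‖)
      = k * (√ε * ‖T (reg S ε F)‖) * (√ε * ‖T (reg S ε w)‖) := by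
    nth_rw 1 [← Real.mul_self_sqrt hε.le]; ring
  have hk := hX.nonneg
  have h5 : ‖F‖ * ‖F‖ ≤ (δ + k * √(ε * ‖T (reg S ε w)‖ ^ 2)) * ‖F‖ := by
    calc ‖F‖ * ‖F‖ = ‖((‖F‖ : ℂ)) ^ 2‖ := by simp [sq]
      _ ≤ _ := h1
      _ ≤ δ * ‖F‖ + k * ‖F‖ * (√ε * ‖T (reg S ε w)‖) := by
        rw [h4]
        gcongr
        exact h.norm_sq_reg_le hε F
      _ = _ := by rw [h3]; ring
  rcases (norm_nonneg F).eq_or_lt with h0 | h0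
  · rw [← h0]; positivity
  · exact le_of_mul_le_mul_right h5 h0

/-- This is the commutator theorem: every point of the graph of `X*` is a limit of points of the
graph of `X` on `D(Λ)`, so `X` is essentially selfadjoint there. -/
lemma tendsto_reg (hX : GJNOp S T X k) (h : IsScale S T) {w y : H}
    (hwy : ∀ z, ⟪X z, w⟫_ℂ = ⟪S z, y⟫_ℂ) :
    Tendsto (fun ε => X (reg S ε w)) (𝓝[>] 0) (𝓝 y) := by
  have h1 : Tendsto (fun ε => k * √(ε * ‖T (reg S ε w)‖ ^ 2)) (𝓝[>] 0) (𝓝 0) := by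
    have := ((Real.continuous_sqrt.tendsto 0).comp (h.tendsto_mul_sqrt_reg_sq w)).const_mul k
    simpa using this
  have h2 : Tendsto (fun ε => X (reg S ε w) - S (reg S ε y)) (𝓝[>] 0) (𝓝 0) := by
    refine squeeze_zero_norm' ?_ h1
    filter_upwards [self_mem_nhdsWithin] with ε (hε : 0 < ε)
    have := hX.norm_reg_sub_le h (w := w) (y := y) le_rfl (fun z => by simp [hwy z]) hε
    simpa using this
  simpa using h2.add (h.tendsto_reg y)

lemma inner_conj_eq (hX : GJNOp S T X k) (h : IsScale S T) {w y : H}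
    (hwy : ∀ z, ⟪X z, w⟫_ℂ = ⟪S z, y⟫_ℂ) : ⟪y, w⟫_ℂ = ⟪w, y⟫_ℂ := by
  have h1 := (hX.tendsto_reg h hwy).inner (𝕜 := ℂ) (h.tendsto_reg w)
  have h2 := (h.tendsto_reg w).inner (𝕜 := ℂ) (hX.tendsto_reg h hwy)
  refine tendsto_nhds_unique h1 (h2.congr fun ε => ?_)
  rw [hX.symm]

lemma norm_add_sq_eq (hX : GJNOp S T X k) (h : IsScale S T) {w y : H}
    (hwy : ∀ z, ⟪X z, w⟫_ℂ = ⟪S z, y⟫_ℂ) (ν : ℝ) :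
    ‖w + (I * ν) • y‖ ^ 2 = ‖w‖ ^ 2 + ν ^ 2 * ‖y‖ ^ 2 := by
  have h1 : (⟪w, y⟫_ℂ).im = 0 := by
    have := congrArg Complex.im (hX.inner_conj_eq h hwy)
    rw [← inner_conj_symm, Complex.conj_im] at this
    linarith
  rw [norm_add_sq (𝕜 := ℂ), inner_smul_right, norm_smul]
  simp [h1, mul_pow]

lemma norm_le_of_add_eq (hX : GJNOp S T X k) (h : IsScale S T) {w y φ : H}
    (hwy : ∀ z, ⟪X z, w⟫_ℂ = ⟪S z, y⟫_ℂ) {ν : ℝ} (hφ : w + (I * ν) • y = φ) :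
    ‖w‖ ≤ ‖φ‖ ∧ |ν| * ‖y‖ ≤ ‖φ‖ := by
  have := hX.norm_add_sq_eq h hwy ν
  rw [hφ] at this
  constructor
  · refine le_of_sq_le_sq ?_ (norm_nonneg _)
    nlinarith [sq_nonneg (ν * ‖y‖)]
  · refine le_of_sq_le_sq ?_ (norm_nonneg _)
    rw [mul_pow, sq_abs]
    nlinarith [sq_nonneg ‖w‖]

/-- Solves `(1 + iνX*) w = φ`. The range of `1 + iνX` on `D(Λ)` is dense, and the equation bounds
both `S z` and `X z`, so approximate solutions converge. -/
lemma exists_resolvent (hX : GJNOp S T X k) (h : IsScale S T) {ν : ℝ} (hν : ν ≠ 0) (φ : H) :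
    ∃ w y, (∀ z, ⟪X z, w⟫_ℂ = ⟪S z, y⟫_ℂ) ∧ w + (I * ν) • y = φ := by
  set B : H →L[ℂ] H := S + (I * ν : ℂ) • X with hB
  have hBa : ∀ z, B z = S z + (I * ν : ℂ) • X z := fun z => rfl
  have hd : B.range.topologicalClosure = ⊤ := by
    rw [Submodule.topologicalClosure_eq_top_iff, Submodule.eq_bot_iff]
    intro x hx
    rw [Submodule.mem_orthogonal] at hx
    have hc : (I * ν : ℂ) ≠ 0 := mul_ne_zero I_ne_zero (by exact_mod_cast hν)
    -- A vector orthogonal to the range is an eigenvector of `X*` with nonreal eigenvalue, or zero;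
    -- symmetry of `X*` leaves only zero.
    have h1 : ∀ z, ⟪X z, x⟫_ℂ = ⟪S z, (I * ν : ℂ)⁻¹ • x⟫_ℂ := by
      intro z
      have h2 := hx (B z) ⟨z, rfl⟩
      rw [hBa, inner_add_left, inner_smul_left, map_mul, Complex.conj_I, Complex.conj_ofReal] at h2
      rw [inner_smul_right, eq_comm, inv_mul_eq_iff_eq_mul₀ hc]
      linear_combination h2
    have h3 := hX.inner_conj_eq h h1
    rw [inner_smul_left, inner_smul_right] at h3
    have h4 : (starRingEnd ℂ) (I * ν : ℂ)⁻¹ = -(I * ν : ℂ)⁻¹ := by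
      rw [map_inv₀, map_mul, Complex.conj_I, Complex.conj_ofReal, neg_mul, inv_neg]
    rw [h4] at h3
    have h5 : (I * ν : ℂ)⁻¹ * ⟪x, x⟫_ℂ = 0 := by linear_combination (-1 / 2 : ℂ) * h3
    rcases mul_eq_zero.mp h5 with h6 | h6
    · exact absurd (inv_eq_zero.mp h6) hc
    · exact inner_self_eq_zero.mp h6
  have hφ : φ ∈ closure (Set.range B) := by
    have : φ ∈ (B.range.topologicalClosure : Set H) := by rw [hd]; trivial
    rw [Submodule.topologicalClosure_coe] at this
    exact this
  obtain ⟨f, hf, hlim⟩ := mem_closure_iff_seq_limit.mp hφ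
  choose z hz using hf
  have hnorm : ∀ a, ‖S a‖ ≤ ‖B a‖ ∧ |ν| * ‖X a‖ ≤ ‖B a‖ := fun a =>
    hX.norm_le_of_add_eq h (fun b => hX.symm b a) (hBa a).symm
  have hcau := hlim.cauchySeq
  have hν' : 0 < |ν| := abs_pos.mpr hν
  have hS : CauchySeq fun n => S (z n) := by
    rw [Metric.cauchySeq_iff] at hcau ⊢
    intro ε hε
    obtain ⟨n0, hn0⟩ := hcau ε hε
    refine ⟨n0, fun m hm n hn => ?_⟩
    have := hn0 m hm n hn
    rw [← hz, ← hz, dist_eq_norm, ← map_sub] at this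
    rw [dist_eq_norm, ← map_sub]
    exact (hnorm _).1.trans_lt this
  have hXc : CauchySeq fun n => X (z n) := by
    rw [Metric.cauchySeq_iff] at hcau ⊢
    intro ε hε
    obtain ⟨n0, hn0⟩ := hcau (|ν| * ε) (by positivity)
    refine ⟨n0, fun m hm n hn => ?_⟩
    have := hn0 m hm n hn
    rw [← hz, ← hz, dist_eq_norm, ← map_sub] at this
    rw [dist_eq_norm, ← map_sub]
    exact lt_of_mul_lt_mul_left ((hnorm _).2.trans_lt this) hν'.le
  obtain ⟨w, hw⟩ := cauchySeq_tendsto_of_complete hS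
  obtain ⟨y, hy⟩ := cauchySeq_tendsto_of_complete hXc
  refine ⟨w, y, fun a => ?_, ?_⟩
  · refine tendsto_nhds_unique ((tendsto_const_nhds (x := X a)).inner (𝕜 := ℂ) hw) ?_
    refine ((tendsto_const_nhds (x := S a)).inner (𝕜 := ℂ) hy).congr fun n => ?_
    rw [hX.symm]
  · refine tendsto_nhds_unique (hw.add (hy.const_smul (I * ν : ℂ))) (hlim.congr fun n => ?_)
    rw [← hz, hBa]

/-- For small `ν` the resolvent preserves `D(Λ^{1/2})`: an energy estimate, pairing the regularised
equation with `a = P w` and taking real parts. -/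
lemma sqrt_reg_resolvent_le (hX : GJNOp S T X k) (h : IsScale S T) {w y ζ : H}
    (hwy : ∀ z, ⟪X z, w⟫_ℂ = ⟪S z, y⟫_ℂ) {ν : ℝ} (hζ : w + (I * ν) • y = S ζ)
    (hν : 3 * (|ν| * k) ≤ 1) {ε : ℝ} (hε : 0 < ε) : ‖T (reg S ε w)‖ ≤ 2 * ‖T ζ‖ := by
  set P := reg S ε
  set a := P w with ha
  set F := X a - S (P y) with hF
  have hk := hX.nonneg
  have e1 : S a + (I * ν : ℂ) • X a = S (S (P ζ)) + (I * ν : ℂ) • F := by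
    have := congrArg (fun x => S (P x)) hζ
    simp only [map_add, map_smul] at this
    rw [h.reg_comm hε] at this
    rw [← this, hF, smul_sub]
    abel
  have e2 := congrArg (fun x => ⟪a, x⟫_ℂ) e1
  simp only [inner_add_right, inner_smul_right, h.inner_right a] at e2
  have e3 := congrArg Complex.re e2
  have e4 : (I * ν * ⟪a, X a⟫_ℂ).re = -(ν * (⟪a, X a⟫_ℂ).im) := by simp [mul_assoc]
  have e5 : |ν * (⟪a, X a⟫_ℂ).im| ≤ |ν| * (k / 2 * ‖T a‖ ^ 2) := by
    rw [abs_mul, ← inner_conj_symm, Complex.conj_im, abs_neg]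
    gcongr
    exact hX.comm a
  have e6 : (⟪T a, T (S (P ζ))⟫_ℂ).re ≤ ‖T a‖ * ‖T ζ‖ :=
    (Complex.re_le_norm _).trans ((norm_inner_le_norm _ _).trans
      (by gcongr; exact h.sqrt_reg_le hε ζ))
  have e7 : (I * ν * ⟪a, F⟫_ℂ).re ≤ |ν| * (k * ‖T a‖ * ‖T a‖) := by
    refine (Complex.re_le_norm _).trans ?_
    rw [norm_mul, norm_mul, Complex.norm_I, one_mul, Complex.norm_real, Real.norm_eq_abs]
    gcongr
    have := hX.norm_inner_reg_sub_le h (w := w) (y := y) (δ := 0)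
      (fun z => by simp [hwy z]) hε a
    refine this.trans ?_
    have h2 := h.mul_sqrt_reg_le hε a
    calc 0 * ‖S (P a)‖ + ε * (k * ‖T (P a)‖ * ‖T (P w)‖)
        = k * (ε * ‖T (P a)‖) * ‖T a‖ := by rw [← ha]; ring
      _ ≤ _ := by gcongr
  rw [Complex.add_re, Complex.add_re, e4, ← h.inner_right a, h.inner_self_right,
    Complex.ofReal_re] at e3
  -- The two error terms add up to `(3/2) |ν| k ‖T a‖²`, at most half of the left side of the energy
  -- identity.
  have h8 : ‖T a‖ * ‖T a‖ ≤ (2 * ‖T ζ‖) * ‖T a‖ := by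
    have := (abs_le.mp e5).2
    have h9 : 3 * (|ν| * k) * ‖T a‖ ^ 2 ≤ 1 * ‖T a‖ ^ 2 := by gcongr
    nlinarith
  rcases (norm_nonneg (T a)).eq_or_lt with h0 | h0
  · rw [← h0]; positivity
  · exact le_of_mul_le_mul_right h8 h0

end GJNOp

/-- The hypothesis says that `v` lies in `D(Λ^{1/2})`. The numbers `Re ⟪P v, v⟫` along `ε = 2⁻ⁿ` are
increasing and bounded by `c²`, and each increment dominates `ε ‖P v‖² / 2`. -/
lemma IsScale.tendsto_mul_norm_reg_sq {S T : H →L[ℂ] H} (h : IsScale S T) {v : H} {c : ℝ}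
    (hc : ∀ ε, 0 < ε → ‖T (reg S ε v)‖ ≤ c) :
    Tendsto (fun n : ℕ => (1 / 2 : ℝ) ^ n * ‖reg S ((1 / 2) ^ n) v‖ ^ 2) atTop (𝓝 0) := by
  set ε : ℕ → ℝ := fun n => (1 / 2 : ℝ) ^ n with hεd
  have hε : ∀ n, 0 < ε n := fun n => by positivity
  set a : ℕ → ℝ := fun n => (⟪reg S (ε n) v, v⟫_ℂ).re with had
  have hc0 : 0 ≤ c := (norm_nonneg _).trans (hc 1 one_pos)
  have hbd : ∀ n, a n ≤ c * c := by
    intro n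
    have h1 : Tendsto (fun η => (⟪reg S (ε n) v, S (reg S η v)⟫_ℂ).re) (𝓝[>] 0) (𝓝 (a n)) :=
      (Complex.continuous_re.tendsto _).comp
        ((tendsto_const_nhds (x := reg S (ε n) v)).inner (𝕜 := ℂ) (h.tendsto_reg v))
    refine le_of_tendsto h1 ?_
    filter_upwards [self_mem_nhdsWithin] with η (hη : 0 < η)
    rw [h.inner_right]
    refine (Complex.re_le_norm _).trans ((norm_inner_le_norm _ _).trans ?_)
    gcongr
    exacts [hc _ (hε n), hc _ hη]
  have hstep : ∀ n, 1 / 2 * (ε n * ‖reg S (ε n) v‖ ^ 2) ≤ a (n + 1) - a n := by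
    intro n
    set P := reg S (ε n)
    set R := reg S (ε (n + 1))
    have hεn : ε n = ε (n + 1) + ε (n + 1) := by
      simp only [hεd, pow_succ]; ring
    -- The resolvent identity; halving makes the difference of the two parameters equal to the
    -- smaller one.
    have e1 : R v = P v + (ε (n + 1) : ℂ) • R (P v) := by
      have q1 : R (S (P v)) + (ε n : ℂ) • R (P v) = R v := by
        rw [← map_smul, ← map_add, h.reg_right (hε n) v]
      have q2 : R (S (P v)) + (ε (n + 1) : ℂ) • R (P v) = P v := h.reg_left (hε (n + 1)) (P v)
      have q3 : (ε n : ℂ) = ε (n + 1) + ε (n + 1) := by exact_mod_cast hεn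
      rw [← q1, q3, add_smul, ← add_assoc, q2]
    have e2 : ⟪R (P v), v⟫_ℂ = ⟪P v, P v⟫_ℂ + ε (n + 1) * ⟪P v, R (P v)⟫_ℂ := by
      rw [h.reg_symm (hε (n + 1)), e1, inner_add_right, inner_smul_right]
    have e3 : 0 ≤ (⟪P v, R (P v)⟫_ℂ).re := by
      set x := P v
      conv => enter [2, 1, 2]; rw [← h.reg_right (hε (n + 1)) x]
      rw [inner_add_left, inner_smul_left, Complex.conj_ofReal, h.inner_self_left,
        Complex.add_re, Complex.ofReal_re, Complex.re_ofReal_mul]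
      have := (hε (n + 1)).le
      have : 0 ≤ (⟪reg S (ε (n + 1)) x, reg S (ε (n + 1)) x⟫_ℂ).re :=
        inner_self_nonneg (𝕜 := ℂ)
      positivity
    have e4 : a (n + 1) - a n = ε (n + 1) * (⟪R (P v), v⟫_ℂ).re := by
      simp only [had]
      change (⟪R v, v⟫_ℂ).re - (⟪P v, v⟫_ℂ).re = _
      rw [e1, inner_add_left, inner_smul_left, Complex.conj_ofReal, Complex.add_re,
        Complex.re_ofReal_mul]
      ring
    have e5 : (⟪P v, P v⟫_ℂ).re = ‖P v‖ ^ 2 :=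
      inner_self_eq_norm_sq (𝕜 := ℂ) (P v)
    rw [e4, e2, Complex.add_re, Complex.re_ofReal_mul, e5, hεn]
    have := hε (n + 1)
    have : 0 ≤ ε (n + 1) * (ε (n + 1) * (⟪P v, R (P v)⟫_ℂ).re) := by positivity
    nlinarith
  have hmono : Monotone a := monotone_nat_of_le_succ fun n => by
    have := hstep n
    have h2 : 0 ≤ 1 / 2 * (ε n * ‖reg S (ε n) v‖ ^ 2) := by
      have := (hε n).le
      positivity
    linarith
  have hlim := tendsto_atTop_ciSup hmono ⟨c * c, by rintro _ ⟨n, rfl⟩; exact hbd n⟩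
  have hdiff : Tendsto (fun n => 2 * (a (n + 1) - a n)) atTop (𝓝 0) := by
    have := (((tendsto_add_atTop_iff_nat 1).mpr hlim).sub hlim).const_mul 2
    simpa using this
  refine squeeze_zero (fun n => ?_) (fun n => ?_) hdiff
  · have := (hε n).le
    positivity
  · have := hstep n
    change ε n * ‖reg S (ε n) v‖ ^ 2 ≤ _
    linarith
/-! ### Approximate eigenvectors in the domain of `N` -/

section Commutator

variable {S T L N D : H →L[ℂ] H} {kN kL kD : ℝ}

/-- With `w = (1 + iνN)⁻¹ S ζ` and `v = (1 - iνN)⁻¹ S ξ` the left side is formally `|ν ⟨v, D w⟩|`.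
As `v` and `w` need not lie in `D(Λ)`, the identity is proved for their regularisations, and the
errors are shown to vanish. -/
lemma norm_comm_resolvent_le (h : IsScale S T) (hN : GJNOp S T N kN) (hL : GJNOp S T L kL)
    (hD : ∀ z, ‖D z‖ ≤ kD * √(‖S z‖ * ‖N z‖))
    (hDeq : ∀ z a, ⟪S z, D a⟫_ℂ = I * (⟪L z, N a⟫_ℂ - ⟪N z, L a⟫_ℂ))
    {ν : ℝ} (hν : 0 < ν) (hνk : 3 * (ν * kN) ≤ 1) {w y ζ v u ξ : H}
    (hwy : ∀ z, ⟪N z, w⟫_ℂ = ⟪S z, y⟫_ℂ) (hw : w + (I * ν) • y = S ζ)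
    (hvu : ∀ z, ⟪N z, v⟫_ℂ = ⟪S z, u⟫_ℂ) (hv : v + (I * (-ν : ℝ)) • u = S ξ) :
    ‖⟪L ξ, w⟫_ℂ - ⟪v, L ζ⟫_ℂ‖ ≤ ν * (‖v‖ * (kD * √(‖w‖ * ‖y‖))) := by
  set ε : ℕ → ℝ := fun n => (1 / 2 : ℝ) ^ n with hεd
  have hε : ∀ n, 0 < ε n := fun n => by positivity
  have hε0 : Tendsto ε atTop (𝓝[>] 0) := by
    refine tendsto_nhdsWithin_iff.mpr
      ⟨tendsto_pow_atTop_nhds_zero_of_lt_one (by norm_num) (by norm_num), ?_⟩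
    exact Eventually.of_forall hε
  have hTw : ∀ η, 0 < η → ‖T (reg S η w)‖ ≤ 2 * ‖T ζ‖ := fun η hη =>
    hN.sqrt_reg_resolvent_le h hwy hw (by rwa [abs_of_pos hν]) hη
  have hTv : ∀ η, 0 < η → ‖T (reg S η v)‖ ≤ 2 * ‖T ξ‖ := fun η hη =>
    hN.sqrt_reg_resolvent_le h hvu hv (by rwa [abs_neg, abs_of_pos hν]) hη
  have hkN := hN.nonneg
  -- Here `L` is controlled only by `Λ`, so `L (P b)` may grow; regularity in `D(Λ^{1/2})` gives `√ε
  -- ‖P b‖ → 0`, and the factor `√ε` comes from the commutator of `N` with the regularisation.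
  have herr : ∀ {x g b : H} {c c' : ℝ}, (∀ z, ⟪N z, x⟫_ℂ = ⟪S z, g⟫_ℂ) →
      (∀ η, 0 < η → ‖T (reg S η x)‖ ≤ c) → (∀ η, 0 < η → ‖T (reg S η b)‖ ≤ c') →
      Tendsto (fun n => ‖⟪L (reg S (ε n) b), N (reg S (ε n) x) - S (reg S (ε n) g)⟫_ℂ‖)
        atTop (𝓝 0) := by
    intro x g b c c' hx hc hc'
    have hl := ((Real.continuous_sqrt.tendsto _).comp
      (h.tendsto_mul_norm_reg_sq hc')).const_mul (kN * ‖L‖ * c)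
    rw [Real.sqrt_zero, mul_zero] at hl
    refine squeeze_zero (fun _ => norm_nonneg _) (fun n => ?_) hl
    have h1 := hN.norm_inner_reg_sub_le h (w := x) (y := g) (δ := 0) (fun z => by simp [hx z])
      (hε n) (L (reg S (ε n) b))
    refine h1.trans ?_
    set q := L (reg S (ε n) b)
    have h2 : √(ε n) * ‖T (reg S (ε n) q)‖ ≤ ‖q‖ := by
      refine le_of_sq_le_sq ?_ (norm_nonneg _)
      rw [mul_pow, Real.sq_sqrt (hε n).le]
      exact h.mul_sqrt_reg_sq_le (hε n) q
    have h3 : √(ε n * ‖reg S (ε n) b‖ ^ 2) = √(ε n) * ‖reg S (ε n) b‖ := by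
      rw [Real.sqrt_mul (hε n).le, Real.sqrt_sq (norm_nonneg _)]
    change _ ≤ kN * ‖L‖ * c * √(ε n * ‖reg S (ε n) b‖ ^ 2)
    rw [h3]
    calc 0 * ‖S (reg S (ε n) q)‖ + ε n * (kN * ‖T (reg S (ε n) q)‖ * ‖T (reg S (ε n) x)‖)
        = √(ε n) * (kN * (√(ε n) * ‖T (reg S (ε n) q)‖) * ‖T (reg S (ε n) x)‖) := by
          nth_rw 2 [← Real.mul_self_sqrt (hε n).le]; ring
      _ ≤ √(ε n) * (kN * (‖L‖ * ‖reg S (ε n) b‖) * c) := by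
          exact mul_le_mul_of_nonneg_left (mul_le_mul (mul_le_mul_of_nonneg_left
            (h2.trans (L.le_opNorm _)) hkN) (hc _ (hε n)) (norm_nonneg _) (by positivity))
            (Real.sqrt_nonneg _)
      _ = _ := by ring
  have hE1 := herr (b := v) hwy hTw hTv
  have hE2 := herr (b := w) hvu hTv hTw
  have hid : ∀ n, ⟪L (S (reg S (ε n) ξ)), S (reg S (ε n) w)⟫_ℂ
      - ⟪S (reg S (ε n) v), L (S (reg S (ε n) ζ))⟫_ℂ
      = I * ν * (⟪L (reg S (ε n) v), N (reg S (ε n) w) - S (reg S (ε n) y)⟫_ℂ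
          - ⟪N (reg S (ε n) v) - S (reg S (ε n) u), L (reg S (ε n) w)⟫_ℂ)
        - ν * ⟪S (reg S (ε n) v), D (reg S (ε n) w)⟫_ℂ := by
    intro n
    set P := reg S (ε n)
    have e1 : (I * ν : ℂ) • S (P y) = S (S (P ζ)) - S (P w) := by
      have := congrArg (fun x => S (P x)) hw
      simp only [map_add, map_smul] at this
      rw [h.reg_comm (hε n)] at this
      rw [← this]
      abel
    have e2 : (I * ν : ℂ) • S (P u) = S (P v) - S (S (P ξ)) := by
      have := congrArg (fun x => S (P x)) hv
      simp only [map_add, map_smul] at this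
      rw [h.reg_comm (hε n)] at this
      rw [← this]
      push_cast
      module
    have e3 : I * ν * ⟪L (P v), S (P y)⟫_ℂ = ⟪S (P v), L (S (P ζ))⟫_ℂ - ⟪L (P v), S (P w)⟫_ℂ := by
      rw [← inner_smul_right, e1, inner_sub_right, hL.symm (P v) (S (P ζ))]
    have e4 : I * ν * ⟪S (P u), L (P w)⟫_ℂ
        = ⟪L (S (P ξ)), S (P w)⟫_ℂ - ⟪S (P v), L (P w)⟫_ℂ := by
      have : I * ν * ⟪S (P u), L (P w)⟫_ℂ = -⟪(I * ν : ℂ) • S (P u), L (P w)⟫_ℂ := by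
        rw [inner_smul_left]; simp
      rw [this, e2, inner_sub_left, hL.symm (S (P ξ)) (P w)]
      ring
    rw [hDeq, inner_sub_right, inner_sub_left]
    have e5 := hL.symm (P v) (P w)
    linear_combination e3 - e4 - e5
  have hlimL : Tendsto (fun n => ‖⟪L (S (reg S (ε n) ξ)), S (reg S (ε n) w)⟫_ℂ
      - ⟪S (reg S (ε n) v), L (S (reg S (ε n) ζ))⟫_ℂ‖) atTop
      (𝓝 ‖⟪L ξ, w⟫_ℂ - ⟪v, L ζ⟫_ℂ‖) := by
    have t := fun x => (h.tendsto_reg x).comp hε0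
    have t' := fun x => (L.continuous.tendsto _).comp (t x)
    exact (((t' ξ).inner (𝕜 := ℂ) (t w)).sub ((t v).inner (𝕜 := ℂ) (t' ζ))).norm
  have hlimR : Tendsto (fun n =>
      ν * (‖⟪L (reg S (ε n) v), N (reg S (ε n) w) - S (reg S (ε n) y)⟫_ℂ‖
        + ‖⟪L (reg S (ε n) w), N (reg S (ε n) v) - S (reg S (ε n) u)⟫_ℂ‖)
      + ν * (‖S (reg S (ε n) v)‖ * (kD * √(‖S (reg S (ε n) w)‖ * ‖N (reg S (ε n) w)‖)))) atTop
      (𝓝 (ν * (‖v‖ * (kD * √(‖w‖ * ‖y‖))))) := by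
    have t := fun x => ((h.tendsto_reg x).comp hε0).norm
    have tN := ((hN.tendsto_reg h hwy).comp hε0).norm
    have h1 := ((hE1.add hE2).const_mul ν).add
      (((t v).mul (((Real.continuous_sqrt.tendsto _).comp ((t w).mul tN)).const_mul kD)).const_mul ν)
    simpa using h1
  refine le_of_tendsto_of_tendsto' hlimL hlimR fun n => ?_
  rw [hid]
  refine (norm_sub_le _ _).trans (add_le_add ?_ ?_)
  · rw [norm_mul, norm_mul, Complex.norm_I, one_mul, Complex.norm_real, Real.norm_of_nonneg hν.le]
    gcongr
    refine (norm_sub_le _ _).trans (add_le_add le_rfl (le_of_eq ?_))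
    rw [← inner_conj_symm, RCLike.norm_conj]
  · rw [norm_mul, Complex.norm_real, Real.norm_of_nonneg hν.le]
    gcongr
    exact (norm_inner_le_norm _ _).trans (by gcongr; exact hD _)

/-- The vector is a regularisation of `w = (1 + iνN)⁻¹ S ζ`, where `S ζ` is so close to `ψ` in the
graph of `L` that its own defect is below `√ν`. The constant `c` is chosen before `η` and `ν`, since
stage 2 balances powers of `ν`. -/
theorem exists_regular_approx_eigenvector (h : IsScale S T) (hN : GJNOp S T N kN)
    (hL : GJNOp S T L kL) (hkD : 0 ≤ kD) (hD : ∀ z, ‖D z‖ ≤ kD * √(‖S z‖ * ‖N z‖))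
    (hDeq : ∀ z a, ⟪S z, D a⟫_ℂ = I * (⟪L z, N a⟫_ℂ - ⟪N z, L a⟫_ℂ)) {ψ : H} {e : ℝ}
    (hψ : ∀ η > 0, ∃ ζ, ‖S ζ - ψ‖ < η ∧ ‖L ζ - (e : ℂ) • S ζ‖ < η) :
    ∃ c, 0 < c ∧ ∀ η > 0, ∃ ν₀ > 0, ∀ ν, 0 < ν → ν < ν₀ →
      ∃ z, ‖S z - ψ‖ < η ∧ ‖L z - (e : ℂ) • S z‖ < c * √ν ∧ ‖N z‖ < c / ν := by
  set B := ‖ψ‖ + 1 with hB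
  have hB0 : 0 < B := by positivity
  refine ⟨kD * B + B + 2, by positivity, fun η hη => ?_⟩
  -- A reference vector independent of `ν`: the resolvents tend strongly to the identity as `ν ‖N
  -- ζ₀‖ → 0`, whereas `N ζ` below is not controlled.
  obtain ⟨ζ₀, hζ₀, -⟩ := hψ (η / 8) (by positivity)
  have hkN := hN.nonneg
  refine ⟨min (1 / (3 * (kN + 1))) (η / (8 * (‖N ζ₀‖ + 1))), by positivity, fun ν hν hν₀ => ?_⟩
  have hν1 : 3 * (ν * kN) ≤ 1 := by
    have := (lt_min_iff.mp hν₀).1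
    rw [lt_div_iff₀ (by positivity)] at this
    nlinarith
  have hν2 : ν * ‖N ζ₀‖ ≤ η / 8 := by
    have := (lt_min_iff.mp hν₀).2
    rw [lt_div_iff₀ (by positivity)] at this
    nlinarith
  have hsν : 0 < √ν := Real.sqrt_pos.mpr hν
  obtain ⟨ζ, hζ1, hζ2⟩ := hψ (min (η / 8) (min 1 (√ν))) (by positivity)
  simp only [lt_min_iff] at hζ1 hζ2
  have hζB : ‖S ζ‖ ≤ B := by
    have := norm_le_norm_add_norm_sub ψ (S ζ)
    rw [norm_sub_rev] at this
    linarith [hζ1.2.1]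
  obtain ⟨w, y, hwy, hw⟩ := hN.exists_resolvent h hν.ne' (S ζ)
  obtain ⟨hw1, hy1⟩ := hN.norm_le_of_add_eq h hwy hw
  rw [abs_of_pos hν] at hy1
  have hwψ : ‖w - ψ‖ < η / 2 := by
    have h1 : (w - S ζ₀) + (I * ν : ℂ) • (y - N ζ₀) = (S ζ - S ζ₀) - (I * ν : ℂ) • N ζ₀ := by
      rw [← hw, smul_sub]; abel
    have h2 := (hN.norm_le_of_add_eq h (w := w - S ζ₀) (y := y - N ζ₀) (fun z => by
      rw [inner_sub_right, inner_sub_right, hwy, hN.symm]) h1).1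
    have h3 : ‖(I * ν : ℂ) • N ζ₀‖ = ν * ‖N ζ₀‖ := by
      rw [norm_smul, norm_mul, Complex.norm_I, one_mul, Complex.norm_real,
        Real.norm_of_nonneg hν.le]
    have h4 : ‖S ζ - S ζ₀‖ ≤ ‖S ζ - ψ‖ + ‖S ζ₀ - ψ‖ := by
      rw [show S ζ - S ζ₀ = (S ζ - ψ) - (S ζ₀ - ψ) by abel]
      exact norm_sub_le _ _
    have h5 : ‖w - ψ‖ ≤ ‖w - S ζ₀‖ + ‖S ζ₀ - ψ‖ := by
      rw [show w - ψ = (w - S ζ₀) + (S ζ₀ - ψ) by abel]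
      exact norm_add_le _ _
    have h6 := h2.trans (norm_sub_le _ _)
    linarith [hζ1.1]
  set δ := (kD * B + 1) * √ν with hδ
  -- Weak form of `‖(L - e) w‖ ≤ δ`. Moving the resolvent onto `ξ` leaves its commutator with `L`
  -- and the defect of `S ζ`.
  have hwL : ∀ ξ, ‖⟪L ξ, w⟫_ℂ - ⟪S ξ, (e : ℂ) • w⟫_ℂ‖ ≤ δ * ‖S ξ‖ := by
    intro ξ
    obtain ⟨v, u, hvu, hv⟩ := hN.exists_resolvent h (neg_ne_zero.mpr hν.ne') (S ξ)
    have h1 := norm_comm_resolvent_le h hN hL hD hDeq hν hν1 hwy hw hvu hv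
    have hv1 := (hN.norm_le_of_add_eq h hvu hv).1
    have h2 : ⟪v, S ζ⟫_ℂ = ⟪S ξ, w⟫_ℂ := by
      have hy : ⟪v, y⟫_ℂ = ⟪u, w⟫_ℂ := by
        refine tendsto_nhds_unique ((h.tendsto_reg v).inner (𝕜 := ℂ) (hN.tendsto_reg h hwy)) ?_
        refine ((hN.tendsto_reg h hvu).inner (𝕜 := ℂ) (h.tendsto_reg w)).congr fun η => ?_
        rw [hN.symm]
      rw [← hw, ← hv, inner_add_right, inner_add_left, inner_smul_right, inner_smul_left, hy]
      simp
    have h3 : ⟪L ξ, w⟫_ℂ - ⟪S ξ, (e : ℂ) • w⟫_ℂ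
        = (⟪L ξ, w⟫_ℂ - ⟪v, L ζ⟫_ℂ) + ⟪v, L ζ - (e : ℂ) • S ζ⟫_ℂ := by
      rw [inner_sub_right, inner_smul_right, inner_smul_right, h2]; ring
    -- Here `y = N* w` satisfies `ν ‖y‖ ≤ B`: the square root halves the loss `1/ν` and leaves the
    -- gain `√ν`.
    have h4 : ν * √(‖w‖ * ‖y‖) ≤ √ν * B := by
      rw [← Real.sqrt_sq hν.le, ← Real.sqrt_mul (sq_nonneg ν), Real.sqrt_sq hν.le]
      rw [← Real.sqrt_sq hB0.le, ← Real.sqrt_mul hν.le]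
      refine Real.sqrt_le_sqrt ?_
      have : ‖w‖ * (ν * ‖y‖) ≤ B * B := by
        have := hw1.trans hζB
        have := hy1.trans hζB
        gcongr
      nlinarith
    rw [h3]
    calc _ ≤ ν * (‖v‖ * (kD * √(‖w‖ * ‖y‖))) + ‖v‖ * ‖L ζ - (e : ℂ) • S ζ‖ :=
          (norm_add_le _ _).trans (add_le_add h1 (norm_inner_le_norm _ _))
      _ = ‖v‖ * (kD * (ν * √(‖w‖ * ‖y‖)) + ‖L ζ - (e : ℂ) • S ζ‖) := by ring
      _ ≤ ‖S ξ‖ * (kD * (√ν * B) + √ν) := by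
          gcongr
          exact hζ2.2.2.le
      _ = δ * ‖S ξ‖ := by rw [hδ]; ring
  have hδ0 : 0 ≤ δ := by positivity
  have hS := h.tendsto_reg w
  have hNl := (hN.tendsto_reg h hwy).norm
  have hLl : Tendsto (fun ε => δ + kL * √(ε * ‖T (reg S ε w)‖ ^ 2)) (𝓝[>] 0) (𝓝 δ) := by
    have := (((Real.continuous_sqrt.tendsto 0).comp
      (h.tendsto_mul_sqrt_reg_sq w)).const_mul kL).const_add δ
    simpa using this
  have ev1 := hS.eventually (Metric.ball_mem_nhds w (show 0 < η / 2 by positivity))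
  have hy2 : ‖y‖ < (kD * B + B + 2) / ν := by
    rw [lt_div_iff₀ hν, mul_comm]
    have := hy1.trans hζB
    have : 0 ≤ kD * B := by positivity
    linarith
  have ev2 := hNl.eventually_lt_const hy2
  have ev3 := hLl.eventually_lt_const
    (show δ < (kD * B + B + 2) * √ν by rw [hδ]; gcongr <;> linarith)
  obtain ⟨ε, ⟨hε1, hε2⟩, hε3, hε⟩ :=
    (((ev1.and ev2).and (ev3.and self_mem_nhdsWithin))).exists
  have hε : 0 < ε := hε
  refine ⟨reg S ε w, ?_, ?_, hε2⟩
  · rw [dist_eq_norm] at hε1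
    calc _ = ‖(S (reg S ε w) - w) + (w - ψ)‖ := by congr 1; abel
      _ ≤ _ := norm_add_le _ _
      _ < η := by linarith
  · have := hL.norm_reg_sub_le h hδ0 hwL hε
    rw [map_smul, map_smul] at this
    exact this.trans_lt hε3

end Commutator
/-! ### A discrete Hilbert transform of a unitary operator -/

/-- The derivative of the sum plus `s.card` is `|∑ e^{ijx}|² ≥ 0`, so the sum plus `s.card * θ` is
monotone. The sum vanishes at `0` and `±π`, which confines it in between. -/
lemma abs_sum_sin_div_le (s : Finset ℤ) {θ : ℝ} (h1 : -Real.pi ≤ θ) (h2 : θ ≤ Real.pi) :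
    |∑ j ∈ s, ∑ k ∈ s, ((j - k : ℤ) : ℝ)⁻¹ * Real.sin (((j - k : ℤ) : ℝ) * θ)|
      ≤ Real.pi * s.card := by
  set G : ℝ → ℝ := fun θ =>
    ∑ j ∈ s, ∑ k ∈ s, ((j - k : ℤ) : ℝ)⁻¹ * Real.sin (((j - k : ℤ) : ℝ) * θ) with hG
  have hder : ∀ x, HasDerivAt (fun x => G x + s.card * x)
      ((∑ j ∈ s, Real.cos (j * x)) ^ 2 + (∑ j ∈ s, Real.sin (j * x)) ^ 2) x := by
    intro x
    have h3 : HasDerivAt (fun x => G x + s.card * x)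
        ((∑ j ∈ s, ∑ k ∈ s, ((j - k : ℤ) : ℝ)⁻¹ * (Real.cos (((j - k : ℤ) : ℝ) * x)
          * ((j - k : ℤ) : ℝ))) + s.card) x := by
      refine HasDerivAt.add ?_ (by simpa using (hasDerivAt_id x).const_mul (s.card : ℝ))
      refine HasDerivAt.fun_sum fun j _ => HasDerivAt.fun_sum fun k _ => ?_
      refine HasDerivAt.const_mul _ (HasDerivAt.sin ?_)
      simpa using (hasDerivAt_id x).const_mul ((j - k : ℤ) : ℝ)
    convert h3 using 1
    -- The diagonal terms carry `0⁻¹ = 0` and have derivative zero; `s.card` supplies the missing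
    -- ones.
    have h4 : ((s.card : ℕ) : ℝ) = ∑ j ∈ s, ∑ k ∈ s, if j = k then (1 : ℝ) else 0 := by
      simp
    rw [h4, sq, sq, Finset.sum_mul_sum, Finset.sum_mul_sum, ← Finset.sum_add_distrib,
      ← Finset.sum_add_distrib]
    refine Finset.sum_congr rfl fun j _ => ?_
    rw [← Finset.sum_add_distrib, ← Finset.sum_add_distrib]
    refine Finset.sum_congr rfl fun k _ => ?_
    rw [← Real.cos_sub, ← sub_mul]
    by_cases hjk : j = k
    · simp [hjk]
    · have : ((j - k : ℤ) : ℝ) ≠ 0 := by exact_mod_cast sub_ne_zero.mpr hjk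
      rw [if_neg hjk]
      rw [mul_comm (Real.cos _), inv_mul_cancel_left₀ this, add_zero, Int.cast_sub]
  have hmono : Monotone fun x => G x + s.card * x :=
    monotone_of_hasDerivAt_nonneg hder fun x => by positivity
  have hG0 : G 0 = 0 := by simp [hG]
  have hGpi : G Real.pi = 0 :=
    Finset.sum_eq_zero fun j _ => Finset.sum_eq_zero fun k _ => by
      rw [Real.sin_int_mul_pi, mul_zero]
  have hGpi' : G (-Real.pi) = 0 :=
    Finset.sum_eq_zero fun j _ => Finset.sum_eq_zero fun k _ => by
      rw [mul_neg, Real.sin_neg, Real.sin_int_mul_pi, neg_zero, mul_zero]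
  change |G θ| ≤ _
  have hc : (0 : ℝ) ≤ s.card := Nat.cast_nonneg _
  rw [abs_le]
  have b1 := hmono h1
  have b2 := hmono h2
  simp only [hGpi, hGpi'] at b1 b2
  rcases le_total 0 θ with h0 | h0
  · have b0 := hmono h0
    simp only [hG0] at b0
    constructor <;> nlinarith
  · have b0 := hmono h0
    simp only [hG0] at b0
    constructor <;> nlinarith

/-- Antisymmetry in `j, k` cancels the cosines and leaves `i` times the sine sum. -/
lemma norm_sum_zpow_div_le (s : Finset ℤ) {z : ℂ} (hz : ‖z‖ = 1) :
    ‖∑ j ∈ s, ∑ k ∈ s, ((j - k : ℤ) : ℂ)⁻¹ * z ^ (j - k)‖ ≤ Real.pi * s.card := by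
  set θ := Complex.arg z
  have hzθ : z = Complex.exp (θ * I) := by
    have := Complex.norm_mul_exp_arg_mul_I z
    rw [hz] at this
    simpa using this.symm
  have hpow : ∀ m : ℤ, z ^ m = Complex.cos ((m : ℝ) * θ : ℝ) + Complex.sin ((m : ℝ) * θ : ℝ) * I := by
    intro m
    rw [hzθ, ← Complex.exp_int_mul, ← Complex.exp_mul_I]
    congr 1
    push_cast
    ring
  set F := ∑ j ∈ s, ∑ k ∈ s, ((j - k : ℤ) : ℂ)⁻¹ * z ^ (j - k) with hF
  have hswap : F = ∑ j ∈ s, ∑ k ∈ s, -(((j - k : ℤ) : ℂ)⁻¹ * z ^ (k - j)) := by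
    rw [hF, Finset.sum_comm]
    refine Finset.sum_congr rfl fun j _ => Finset.sum_congr rfl fun k _ => ?_
    rw [← neg_mul, ← inv_neg]
    push_cast
    rw [neg_sub]
  have h2F : 2 * F = 2 * (I * ((∑ j ∈ s, ∑ k ∈ s,
      ((j - k : ℤ) : ℝ)⁻¹ * Real.sin (((j - k : ℤ) : ℝ) * θ) : ℝ) : ℂ)) := by
    have : 2 * F = F + ∑ j ∈ s, ∑ k ∈ s, -(((j - k : ℤ) : ℂ)⁻¹ * z ^ (k - j)) := by
      rw [← hswap]; ring
    rw [this, hF, ← Finset.sum_add_distrib]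
    push_cast
    rw [Finset.mul_sum, Finset.mul_sum]
    refine Finset.sum_congr rfl fun j _ => ?_
    rw [← Finset.sum_add_distrib, Finset.mul_sum, Finset.mul_sum]
    refine Finset.sum_congr rfl fun k _ => ?_
    rw [show k - j = -(j - k) by ring, hpow, hpow]
    push_cast
    rw [show (-((j : ℂ) - k)) * θ = -(((j : ℂ) - k) * θ) by ring, Complex.cos_neg, Complex.sin_neg]
    ring
  rw [mul_left_cancel₀ two_ne_zero h2F, norm_mul, Complex.norm_I, one_mul, Complex.norm_real,
    Real.norm_eq_abs]
  exact abs_sum_sin_div_le s (Complex.neg_pi_lt_arg z).le (Complex.arg_le_pi z)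

/-- The spectrum lies on the unit circle, so the continuous functional calculus transfers the scalar
bound. -/
lemma norm_sum_unitary_zpow_div_le (s : Finset ℤ) (W : unitary (H →L[ℂ] H)) :
    ‖∑ j ∈ s, ∑ k ∈ s, ((j - k : ℤ) : ℂ)⁻¹ • ((W ^ (j - k) : unitary (H →L[ℂ] H)) : H →L[ℂ] H)‖
      ≤ Real.pi * s.card := by
  set a : (H →L[ℂ] H)ˣ := Unitary.toUnits W with ha
  have haW : (a : H →L[ℂ] H) = W := rfl
  have hn : IsStarNormal (a : H →L[ℂ] H) := by
    rw [haW]; infer_instance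
  have hsp : ∀ z ∈ spectrum ℂ (a : H →L[ℂ] H), ‖z‖ = 1 := fun z hz => by
    have := spectrum.subset_circle_of_unitary W.2 hz
    simpa using this
  have hcont : ∀ m : ℤ, ContinuousOn (fun z : ℂ => z ^ m) (spectrum ℂ (a : H →L[ℂ] H)) :=
    fun m => continuousOn_id.zpow₀ m fun z hz => Or.inl fun h0 => by
      have := hsp z hz
      simp only [id] at h0
      rw [h0, norm_zero] at this
      exact zero_ne_one this
  have hcfc : cfc (fun z : ℂ => ∑ j ∈ s, ∑ k ∈ s, ((j - k : ℤ) : ℂ)⁻¹ * z ^ (j - k))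
      (a : H →L[ℂ] H)
      = ∑ j ∈ s, ∑ k ∈ s, ((j - k : ℤ) : ℂ)⁻¹ • ((W ^ (j - k) : unitary (H →L[ℂ] H)) : H →L[ℂ] H) := by
    have h1 : ∀ j k : ℤ, ContinuousOn (fun z : ℂ => ((j - k : ℤ) : ℂ)⁻¹ * z ^ (j - k))
        (spectrum ℂ (a : H →L[ℂ] H)) := fun j k => continuousOn_const.mul (hcont _)
    have e1 : (fun z : ℂ => ∑ j ∈ s, ∑ k ∈ s, ((j - k : ℤ) : ℂ)⁻¹ * z ^ (j - k))
        = ∑ j ∈ s, ∑ k ∈ s, fun z : ℂ => ((j - k : ℤ) : ℂ)⁻¹ * z ^ (j - k) := by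
      ext z; simp only [Finset.sum_apply]
    rw [e1, cfc_sum _ _ _ fun j _ => ?_]
    swap
    · have : (∑ k ∈ s, fun z : ℂ => ((j - k : ℤ) : ℂ)⁻¹ * z ^ (j - k))
          = fun z : ℂ => ∑ k ∈ s, ((j - k : ℤ) : ℂ)⁻¹ * z ^ (j - k) := by
        ext z; simp only [Finset.sum_apply]
      rw [this]
      exact continuousOn_finsetSum s fun k _ => h1 j k
    refine Finset.sum_congr rfl fun j _ => ?_
    rw [cfc_sum _ _ _ fun k _ => h1 j k]
    refine Finset.sum_congr rfl fun k _ => ?_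
    rw [cfc_const_mul _ _ _ (hcont _), cfc_zpow a _ hn]
    congr 1
    rw [ha, ← map_zpow]
    rfl
  rw [← hcfc]
  refine norm_cfc_le (by positivity) fun z hz => ?_
  exact norm_sum_zpow_div_le s (hsp z hz)

/-! ### A Taylor estimate -/

lemma norm_le_of_hasDerivAt_pow {f f' : ℝ → ℂ} (hf : ∀ y, HasDerivAt f (f' y) y) (h0 : f 0 = 0)
    {c ρ : ℝ} (hc : 0 ≤ c) (n : ℕ) (hb : ∀ y, |y| ≤ ρ → ‖f' y‖ ≤ c * |y| ^ n) {y : ℝ} (hy : |y| ≤ ρ) :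
    ‖f y‖ ≤ c * |y| ^ (n + 1) := by
  have := (convex_Icc (-|y|) |y|).norm_image_sub_le_of_norm_hasDerivWithin_le
    (f := f) (f' := f') (C := c * |y| ^ n) (x := 0) (y := y)
    (fun x _ => (hf x).hasDerivWithinAt)
    (fun x hx => by
      have hx' := abs_le.mpr hx
      refine (hb x (hx'.trans hy)).trans ?_
      gcongr)
    ⟨by simp, by simp⟩ (abs_le.mp le_rfl)
  rw [h0, sub_zero, sub_zero, Real.norm_eq_abs] at this
  rw [pow_succ, ← mul_assoc]
  exact this

/-- Everything is expanded at the midpoint `-u/2`. The symmetric sum of `γ₁` and the central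
difference quotient of `γ₀` both lose their `γ₂` term, so only `γ₃` enters. -/
lemma norm_taylor_midpoint_le {γ₀ γ₁ γ₂ γ₃ : ℝ → ℂ} (h₀ : ∀ r, HasDerivAt γ₀ (γ₁ r) r)
    (h₁ : ∀ r, HasDerivAt γ₁ (γ₂ r) r) (h₂ : ∀ r, HasDerivAt γ₂ (γ₃ r) r) {c α u x : ℝ}
    (hc : 0 ≤ c) (hγ : ∀ r, |r| ≤ 2 * α → ‖γ₃ r‖ ≤ c) (hu0 : u ≠ 0) (hu : |u| ≤ 2 * α)
    (hx : |x| ≤ α) :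
    ‖γ₁ (-u / 2 + x) + γ₁ (-u / 2 - x) - 2 * ((u : ℂ)⁻¹ * (γ₀ 0 - γ₀ (-u)))‖ ≤ 4 * c * α ^ 2 := by
  set m := -u / 2 with hm
  have hmα : |m| ≤ α := by
    rw [hm, abs_div, abs_neg, abs_two]; linarith
  have hadd : ∀ {f f' : ℝ → ℂ}, (∀ r, HasDerivAt f (f' r) r) →
      ∀ y, HasDerivAt (fun y => f (m + y)) (f' (m + y)) y := fun hf y =>
    (hf (m + y)).comp_const_add m y
  have hid : ∀ (v : ℂ) (y : ℝ), HasDerivAt (fun y : ℝ => (y : ℂ) * v) v y := fun v y => by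
    simpa using ((hasDerivAt_id y).ofReal_comp).mul_const v
  have hsq : ∀ (v : ℂ) (y : ℝ), HasDerivAt (fun y : ℝ => (y : ℂ) ^ 2 / 2 * v) (y * v) y := by
    intro v y
    have := (((hasDerivAt_id y).ofReal_comp).pow 2).div_const 2 |>.mul_const v
    simpa using this
  have t2 : ∀ y, |y| ≤ α → ‖γ₂ (m + y) - γ₂ m‖ ≤ c * |y| ^ 1 := fun y hy =>
    norm_le_of_hasDerivAt_pow (f := fun y => γ₂ (m + y) - γ₂ m) (f' := fun y => γ₃ (m + y))
      (fun y => (hadd h₂ y).sub_const _) (by simp) hc 0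
      (fun y hy => by
        rw [pow_zero, mul_one]
        exact hγ _ ((abs_add_le _ _).trans (by linarith))) hy
  have t1 : ∀ y, |y| ≤ α → ‖γ₁ (m + y) - γ₁ m - y * γ₂ m‖ ≤ c * |y| ^ 2 := fun y hy =>
    norm_le_of_hasDerivAt_pow (f := fun y => γ₁ (m + y) - γ₁ m - y * γ₂ m)
      (fun y => ((hadd h₁ y).sub_const _).sub (hid _ y)) (by simp) hc 1 t2 hy
  have t0 : ∀ y, |y| ≤ α → ‖γ₀ (m + y) - γ₀ m - y * γ₁ m - (y : ℂ) ^ 2 / 2 * γ₂ m‖ ≤ c * |y| ^ 3 :=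
    fun y hy =>
    norm_le_of_hasDerivAt_pow (f := fun y => γ₀ (m + y) - γ₀ m - y * γ₁ m - (y : ℂ) ^ 2 / 2 * γ₂ m)
      (fun y => (((hadd h₀ y).sub_const _).sub (hid _ y)).sub (hsq _ y)) (by simp) hc 2 t1 hy
  have hm0 : |-m| ≤ α := by rwa [abs_neg]
  have a1 := t0 (-m) hm0
  have a2 := t0 m hmα
  have a3 := t1 x hx
  have a4 := t1 (-x) (by rwa [abs_neg])
  rw [abs_neg] at a1 a4
  have hmu : m + m = -u := by rw [hm]; ring
  rw [add_neg_cancel] at a1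
  rw [hmu] at a2
  rw [← sub_eq_add_neg] at a4
  have huc : (u : ℂ) ≠ 0 := by exact_mod_cast hu0
  have hmc : (m : ℂ) = -u / 2 := by rw [hm]; push_cast; ring
  set q := (γ₀ 0 - γ₀ m - (-m : ℝ) * γ₁ m - ((-m : ℝ) : ℂ) ^ 2 / 2 * γ₂ m)
    - (γ₀ (-u) - γ₀ m - m * γ₁ m - (m : ℂ) ^ 2 / 2 * γ₂ m) with hq
  have hqe : q = γ₀ 0 - γ₀ (-u) - u * γ₁ m := by
    rw [hq]; push_cast; rw [hmc]; ring
  have hqn : ‖q‖ ≤ 2 * (c * |m| ^ 3) := (norm_sub_le _ _).trans (by linarith)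
  have hqn' : ‖(u : ℂ)⁻¹ * q‖ ≤ c * α ^ 2 := by
    have hum : |u| = 2 * |m| := by rw [hm, abs_div, abs_neg, abs_two]; ring
    have hu1 : 0 < |u| := abs_pos.mpr hu0
    rw [norm_mul, norm_inv, Complex.norm_real, Real.norm_eq_abs, inv_mul_le_iff₀ hu1]
    have : |m| ^ 2 ≤ α ^ 2 := by gcongr
    calc ‖q‖ ≤ 2 * (c * |m| ^ 3) := hqn
      _ = |u| * (c * |m| ^ 2) := by rw [hum]; ring
      _ ≤ _ := by gcongr
  have hx2 : |x| ^ 2 ≤ α ^ 2 := by gcongr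
  have e : γ₁ (m + x) + γ₁ (m - x) - 2 * ((u : ℂ)⁻¹ * (γ₀ 0 - γ₀ (-u)))
      = ((γ₁ (m + x) - γ₁ m - x * γ₂ m) + (γ₁ (m - x) - γ₁ m - (-x : ℝ) * γ₂ m))
        - 2 * ((u : ℂ)⁻¹ * q) := by
    rw [hqe, mul_sub (u : ℂ)⁻¹ _ (u * γ₁ m), inv_mul_cancel_left₀ huc]
    push_cast
    ring
  rw [e]
  calc _ ≤ (c * |x| ^ 2 + c * |x| ^ 2) + 2 * (c * α ^ 2) := by
        refine (norm_sub_le _ _).trans (add_le_add ((norm_add_le _ _).trans (add_le_add a3 a4)) ?_)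
        rw [norm_mul, Complex.norm_ofNat]
        gcongr
    _ ≤ 4 * c * α ^ 2 := by nlinarith
/-! ### Unitary groups leaving the range of `S` invariant -/

section Group

variable {S T : H →L[ℂ] H}

/-- The map `Λ B Λ⁻¹` is everywhere defined, hence bounded by the closed graph theorem. -/
lemma exists_conj_of_invariant (h : IsScale S T) {B : H →L[ℂ] H} (hB : ∀ z, ∃ z', B (S z) = S z') :
    ∃ V : H →L[ℂ] H, ∀ z, B (S z) = S (V z) := by
  choose f hf using hB
  let V : H →ₗ[ℂ] H :=
    { toFun := f
      map_add' := fun x y => h.injective (by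
        rw [← hf, map_add, map_add, map_add, hf, hf])
      map_smul' := fun c x => h.injective (by
        rw [← hf, map_smul, map_smul, RingHom.id_apply, map_smul, hf]) }
  refine ⟨⟨V, V.continuous_of_seq_closed_graph fun u x y hu hV => h.injective ?_⟩, hf⟩
  refine tendsto_nhds_unique ((S.continuous.tendsto _).comp hV) ?_
  have : Tendsto (fun n => B (S (u n))) atTop (𝓝 (B (S x))) :=
    ((B.continuous.comp S.continuous).tendsto _).comp hu
  rw [hf x] at this
  exact this.congr fun n => hf _

variable {U : ℝ → unitary (H →L[ℂ] H)} {V : ℝ → H →L[ℂ] H}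

lemma unitary_inner_map (W : unitary (H →L[ℂ] H)) (x y : H) :
    ⟪(W : H →L[ℂ] H) x, (W : H →L[ℂ] H) y⟫_ℂ = ⟪x, y⟫_ℂ := by
  have h1 : ContinuousLinearMap.adjoint (W : H →L[ℂ] H) ((W : H →L[ℂ] H) y) = y := by
    have := congrArg (fun F : H →L[ℂ] H => F y) (Unitary.coe_star_mul_self W)
    simpa [ContinuousLinearMap.star_eq_adjoint] using this
  rw [← ContinuousLinearMap.adjoint_inner_right, h1]

lemma unitary_norm_map (W : unitary (H →L[ℂ] H)) (x : H) : ‖(W : H →L[ℂ] H) x‖ = ‖x‖ := by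
  rw [@norm_eq_sqrt_re_inner ℂ, @norm_eq_sqrt_re_inner ℂ, unitary_inner_map]

lemma conj_add (h : IsScale S T) (hadd : ∀ s t, U (s + t) = U s * U t)
    (hV : ∀ t z, (U t : H →L[ℂ] H) (S z) = S (V t z)) (s t : ℝ) (z : H) :
    V (s + t) z = V s (V t z) := by
  apply h.injective
  rw [← hV, ← hV, ← hV, hadd]
  rfl

/-- A Baire argument: the sublevel sets of `‖V t‖` are closed and cover the line, so one contains an
interval, which the group law moves to zero. -/
lemma exists_eventually_norm_conj_le (h : IsScale S T) (hadd : ∀ s t, U (s + t) = U s * U t)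
    (hU : ∀ φ : H, Continuous fun t => (U t : H →L[ℂ] H) φ)
    (hV : ∀ t z, (U t : H →L[ℂ] H) (S z) = S (V t z)) : ∃ c, ∀ᶠ t in 𝓝 0, ‖V t‖ ≤ c := by
  -- In this form only `U t` appears, which is strongly continuous; continuity of `V` is not known
  -- yet.
  let F : ℕ → Set ℝ := fun n => {t | ∀ x z, ‖⟪x, (U t : H →L[ℂ] H) (S z)⟫_ℂ‖ ≤ n * ‖S x‖ * ‖z‖}
  have hF : ∀ n t, t ∈ F n ↔ ‖V t‖ ≤ n := by
    intro n t
    have e : ∀ x z, ⟪x, (U t : H →L[ℂ] H) (S z)⟫_ℂ = ⟪S x, V t z⟫_ℂ := fun x z => by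
      rw [hV, h.symm_sq]
    constructor
    · intro ht
      refine ContinuousLinearMap.opNorm_le_bound _ (Nat.cast_nonneg _) fun z => ?_
      have hb : ∀ b, ‖⟪b, V t z⟫_ℂ‖ ≤ n * ‖b‖ * ‖z‖ := by
        refine fun b => h.dense.induction_on (p := fun b => ‖⟪b, V t z⟫_ℂ‖ ≤ n * ‖b‖ * ‖z‖) b ?_ ?_
        · exact isClosed_le (by fun_prop) (by fun_prop)
        · intro x
          rw [← e]
          exact ht x z
      have := hb (V t z)
      rw [inner_self_eq_norm_sq_to_K, norm_pow, RCLike.norm_ofReal, abs_norm, sq] at this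
      rcases (norm_nonneg (V t z)).eq_or_lt with h0 | h0
      · rw [← h0]; positivity
      · exact le_of_mul_le_mul_right (this.trans_eq (by ring)) h0
    · intro ht x z
      rw [e]
      calc _ ≤ ‖S x‖ * ‖V t z‖ := norm_inner_le_norm _ _
        _ ≤ ‖S x‖ * (n * ‖z‖) := by
          gcongr
          exact (V t).le_of_opNorm_le ht z
        _ = _ := by ring
  have hcl : ∀ n, IsClosed (F n) := by
    intro n
    have : F n = ⋂ x, ⋂ z, {t | ‖⟪x, (U t : H →L[ℂ] H) (S z)⟫_ℂ‖ ≤ n * ‖S x‖ * ‖z‖} := by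
      ext t; simp [F]
    rw [this]
    exact isClosed_iInter fun x => isClosed_iInter fun z =>
      isClosed_le (continuous_const.inner (hU _)).norm continuous_const
  have hun : ⋃ n, F n = Set.univ := by
    rw [Set.eq_univ_iff_forall]
    intro t
    obtain ⟨n, hn⟩ := exists_nat_ge ‖V t‖
    exact Set.mem_iUnion.mpr ⟨n, (hF n t).mpr hn⟩
  obtain ⟨n, t₀, ht₀⟩ := nonempty_interior_of_iUnion_of_closed hcl hun
  refine ⟨‖V (-t₀)‖ * n, ?_⟩
  have h1 : ∀ᶠ t in 𝓝 (0 : ℝ), t₀ + t ∈ F n := by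
    have hc : Tendsto (fun t : ℝ => t₀ + t) (𝓝 0) (𝓝 t₀) := by
      have : Continuous fun t : ℝ => t₀ + t := by fun_prop
      simpa using this.tendsto 0
    exact hc.eventually (mem_interior_iff_mem_nhds.mp ht₀)
  filter_upwards [h1] with t ht
  refine ContinuousLinearMap.opNorm_le_bound _ (by positivity) fun z => ?_
  have e1 : V t z = V (-t₀) (V (t₀ + t) z) := by
    rw [← conj_add h hadd hV]
    congr 2
    ring
  rw [e1]
  calc _ ≤ ‖V (-t₀)‖ * ‖V (t₀ + t) z‖ := (V (-t₀)).le_opNorm _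
    _ ≤ ‖V (-t₀)‖ * (n * ‖z‖) := by
      gcongr
      exact (V (t₀ + t)).le_of_opNorm_le ((hF n _).mp ht) z
    _ = _ := by ring

/-- A product rule in which `V t b → b` is needed only weakly: it is paired with the norm-convergent
difference quotient of `U t (S a)`. In the other term symmetry moves `X` onto `a`, so `X U t (S b)`
is never differentiated. -/
lemma hasDerivAt_inner_conj (h : IsScale S T) (h0 : U 0 = 1)
    (hadd : ∀ s t, U (s + t) = U s * U t)
    (hU : ∀ φ : H, Continuous fun t => (U t : H →L[ℂ] H) φ)
    (hV : ∀ t z, (U t : H →L[ℂ] H) (S z) = S (V t z)) {X Y : H →L[ℂ] H}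
    (hX : ∀ z y, ⟪X z, S y⟫_ℂ = ⟪S z, X y⟫_ℂ) {a b p q : H}
    (hp : HasDerivAt (fun t => (U t : H →L[ℂ] H) (S a)) (I • p) 0)
    (hq : HasDerivAt (fun t => (U t : H →L[ℂ] H) (S b)) (I • q) 0)
    (hY : ⟪S a, Y b⟫_ℂ = I * (⟪X a, q⟫_ℂ - ⟪p, X b⟫_ℂ)) :
    HasDerivAt (fun t => ⟪(U t : H →L[ℂ] H) (S a), X (V t b)⟫_ℂ) ⟪S a, Y b⟫_ℂ 0 := by
  have hU0 : ∀ x, (U 0 : H →L[ℂ] H) x = x := fun x => by rw [h0]; rfl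
  have hV0 : ∀ z, V 0 z = z := fun z => h.injective (by rw [← hV, hU0])
  obtain ⟨c, hc⟩ := exists_eventually_norm_conj_le h hadd hU hV
  have hweak : ∀ x, Tendsto (fun t => ⟪x, V t b⟫_ℂ) (𝓝 0) (𝓝 ⟪x, b⟫_ℂ) := by
    intro x
    rw [Metric.tendsto_nhds]
    intro η hη
    have hC : 0 < |c| * ‖b‖ + ‖b‖ + 1 := by positivity
    obtain ⟨y, hy⟩ := h.dense.exists_dist_lt x
      (show 0 < η / (2 * (|c| * ‖b‖ + ‖b‖ + 1)) by positivity)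
    rw [dist_eq_norm, lt_div_iff₀ (by positivity)] at hy
    have h1 : Tendsto (fun t => ⟪y, (U t : H →L[ℂ] H) (S b)⟫_ℂ) (𝓝 0) (𝓝 ⟪y, S b⟫_ℂ) := by
      have := (continuous_const (y := y)).inner (𝕜 := ℂ) (hU (S b))
      simpa [hU0] using this.tendsto 0
    filter_upwards [Metric.tendsto_nhds.mp h1 (η / 2) (by positivity), hc] with t ht1 ht2
    rw [dist_eq_norm, hV, ← h.symm_sq, ← h.symm_sq, ← inner_sub_right] at ht1
    rw [dist_eq_norm, ← inner_sub_right]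
    have e1 : ⟪x, V t b - b⟫_ℂ = ⟪x - S y, V t b - b⟫_ℂ + ⟪S y, V t b - b⟫_ℂ := by
      rw [← inner_add_left, sub_add_cancel]
    have h2 : ‖V t b - b‖ ≤ |c| * ‖b‖ + ‖b‖ := by
      refine (norm_sub_le _ _).trans (add_le_add ?_ le_rfl)
      exact (V t).le_of_opNorm_le (ht2.trans (le_abs_self c)) b
    rw [e1]
    calc _ ≤ ‖x - S y‖ * ‖V t b - b‖ + ‖⟪S y, V t b - b⟫_ℂ‖ :=
          (norm_add_le _ _).trans (add_le_add (norm_inner_le_norm _ _) le_rfl)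
      _ < η := by nlinarith [norm_nonneg (x - S y)]
  have hweakX : ∀ x, Tendsto (fun t => ⟪x, X (V t b)⟫_ℂ) (𝓝 0) (𝓝 ⟪x, X b⟫_ℂ) := by
    intro x
    have := hweak (ContinuousLinearMap.adjoint X x)
    simpa only [ContinuousLinearMap.adjoint_inner_left] using this
  have hd2 : HasDerivAt (fun t => ⟪X a, (U t : H →L[ℂ] H) (S b)⟫_ℂ) ⟪X a, I • q⟫_ℂ 0 := by
    have := (hasDerivAt_const (0 : ℝ) (X a)).inner ℂ hq
    simpa only [inner_zero_left, add_zero] using this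
  rw [hasDerivAt_iff_tendsto_slope] at hp hd2 ⊢
  have hle : 𝓝[≠] (0 : ℝ) ≤ 𝓝 0 := nhdsWithin_le_nhds
  have h1 : Tendsto (fun t => ⟪slope (fun t => (U t : H →L[ℂ] H) (S a)) 0 t, X (V t b)⟫_ℂ)
      (𝓝[≠] 0) (𝓝 ⟪I • p, X b⟫_ℂ) := by
    have h2 : Tendsto (fun t => ⟪slope (fun t => (U t : H →L[ℂ] H) (S a)) 0 t - I • p,
        X (V t b)⟫_ℂ) (𝓝[≠] 0) (𝓝 0) := by
      have h3 : Tendsto (fun t => ‖slope (fun t => (U t : H →L[ℂ] H) (S a)) 0 t - I • p‖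
          * (‖X‖ * (|c| * ‖b‖))) (𝓝[≠] 0) (𝓝 0) := by
        have := (hp.sub_const (I • p)).norm.mul_const (‖X‖ * (|c| * ‖b‖))
        simpa using this
      refine squeeze_zero_norm' ?_ h3
      filter_upwards [hle hc] with t ht
      refine (norm_inner_le_norm _ _).trans ?_
      gcongr
      refine (X.le_opNorm _).trans ?_
      gcongr
      exact (V t).le_of_opNorm_le (ht.trans (le_abs_self c)) b
    have h4 := h2.add ((hweakX (I • p)).mono_left hle)
    rw [zero_add] at h4
    refine h4.congr fun t => ?_
    rw [← inner_add_left, sub_add_cancel]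
  have h5 := h1.add hd2
  have e : ⟪I • p, X b⟫_ℂ + ⟪X a, I • q⟫_ℂ = ⟪S a, Y b⟫_ℂ := by
    rw [hY, inner_smul_left, inner_smul_right, Complex.conj_I]; ring
  rw [e] at h5
  refine h5.congr fun t => ?_
  simp only [slope_def_module, sub_zero, hU0, hV0]
  have e2 : ⟪X a, (U t : H →L[ℂ] H) (S b)⟫_ℂ = ⟪S a, X (V t b)⟫_ℂ := by rw [hV, hX]
  have e3 : ∀ x : H, (t⁻¹ : ℝ) • x = ((t⁻¹ : ℝ) : ℂ) • x := fun x =>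
    RCLike.real_smul_eq_coe_smul (K := ℂ) _ _
  rw [e2, hX, e3, inner_smul_left, Complex.conj_ofReal, inner_sub_left, Complex.real_smul,
    Complex.real_smul]
  ring

end Group
/-! ### Averages over the unitary group -/

section Average

variable {S T : H →L[ℂ] H} {U : ℝ → unitary (H →L[ℂ] H)} {V : ℝ → H →L[ℂ] H}

lemma unitary_group_int_mul (h0 : U 0 = 1) (hadd : ∀ s t, U (s + t) = U s * U t) (τ : ℝ) (m : ℤ) :
    U (m * τ) = U τ ^ m := by
  let f : Multiplicative ℝ →* unitary (H →L[ℂ] H) :=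
    { toFun := fun t => U t.toAdd
      map_one' := h0
      map_mul' := fun s t => hadd s.toAdd t.toAdd }
  have := map_zpow f (Multiplicative.ofAdd τ) m
  rw [← ofAdd_zsmul, zsmul_eq_mul] at this
  exact this

lemma unitary_group_neg (h0 : U 0 = 1) (hadd : ∀ s t, U (s + t) = U s * U t) (τ : ℝ) :
    U (-τ) = (U τ)⁻¹ := by
  have := unitary_group_int_mul h0 hadd τ (-1)
  simpa using this

lemma norm_sum_inner_unitary_le (s : Finset ℤ) (W : unitary (H →L[ℂ] H)) (φ ξ : H) :
    ‖∑ j ∈ s, ∑ k ∈ s, ((j - k : ℤ) : ℂ)⁻¹ *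
      ⟪ξ, ((W ^ (j - k) : unitary (H →L[ℂ] H)) : H →L[ℂ] H) φ⟫_ℂ‖
      ≤ Real.pi * s.card * (‖φ‖ * ‖ξ‖) := by
  set F := ∑ j ∈ s, ∑ k ∈ s,
    ((j - k : ℤ) : ℂ)⁻¹ • ((W ^ (j - k) : unitary (H →L[ℂ] H)) : H →L[ℂ] H) with hF
  have e : ∑ j ∈ s, ∑ k ∈ s, ((j - k : ℤ) : ℂ)⁻¹ *
      ⟪ξ, ((W ^ (j - k) : unitary (H →L[ℂ] H)) : H →L[ℂ] H) φ⟫_ℂ = ⟪ξ, F φ⟫_ℂ := by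
    rw [hF, sum_apply, inner_sum]
    refine Finset.sum_congr rfl fun j _ => ?_
    rw [sum_apply, inner_sum]
    refine Finset.sum_congr rfl fun k _ => ?_
    rw [smul_apply, inner_smul_right]
  rw [e]
  calc _ ≤ ‖ξ‖ * ‖F φ‖ := norm_inner_le_norm _ _
    _ ≤ ‖ξ‖ * (Real.pi * s.card * ‖φ‖) := by
      gcongr
      exact F.le_of_opNorm_le (norm_sum_unitary_zpow_div_le s W) φ
    _ = _ := by ring

lemma sum_Icc_neg {M : Type*} [AddCommMonoid M] (n : ℕ) (f : ℤ → M) :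
    ∑ j ∈ Finset.Icc (-n : ℤ) n, f (-j) = ∑ j ∈ Finset.Icc (-n : ℤ) n, f j := by
  refine Finset.sum_nbij' (fun j => -j) (fun j => -j) ?_ ?_ ?_ ?_ ?_ <;> simp
  all_goals intros; omega

/-- The reflection `(j, k) ↦ (-k, -j)` preserves `j - k`, so it pairs points symmetric about the
midpoint of a diagonal. -/
lemma two_mul_double_sum (n : ℕ) (q : ℤ → ℤ → ℂ) :
    2 * ∑ j ∈ Finset.Icc (-n : ℤ) n, ∑ k ∈ Finset.Icc (-n : ℤ) n, q j k
      = ∑ j ∈ Finset.Icc (-n : ℤ) n, ∑ k ∈ Finset.Icc (-n : ℤ) n, (q j k + q (-k) (-j)) := by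
  have : ∑ j ∈ Finset.Icc (-n : ℤ) n, ∑ k ∈ Finset.Icc (-n : ℤ) n, q (-k) (-j)
      = ∑ j ∈ Finset.Icc (-n : ℤ) n, ∑ k ∈ Finset.Icc (-n : ℤ) n, q j k := by
    rw [sum_Icc_neg n (fun j => ∑ k ∈ Finset.Icc (-n : ℤ) n, q (-k) j), Finset.sum_comm]
    exact sum_Icc_neg n (fun k => ∑ j ∈ Finset.Icc (-n : ℤ) n, q k j)
  simp only [Finset.sum_add_distrib]
  rw [this, two_mul]

/-- The vector is the mean of `U(jα/n) φ` over `|j| ≤ n`. Off the diagonal the reflected pairs are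
replaced by difference quotients; the diagonal has weight `1/M` and is absorbed in `ε` by taking `n`
large. -/
theorem exists_average (h : IsScale S T) (h0 : U 0 = 1) (hadd : ∀ s t, U (s + t) = U s * U t)
    (hV : ∀ t z, (U t : H →L[ℂ] H) (S z) = S (V t z)) {C : Fin 4 → H →L[ℂ] H} {z : H}
    (hder : ∀ (n : Fin 3) s t,
      HasDerivAt (fun r => ⟪(U (s + r) : H →L[ℂ] H) (S z), C n.castSucc (V (t + r) z)⟫_ℂ)
        ⟪(U s : H →L[ℂ] H) (S z), C n.succ (V t z)⟫_ℂ 0)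
    (hsym : ∀ a b, ⟪C 0 a, S b⟫_ℂ = ⟪S a, C 0 b⟫_ℂ) {α c : ℝ} (hα : 0 < α) (hc0 : 0 ≤ c)
    (hc : ∀ s t, |t| ≤ 2 * α → ‖⟪(U s : H →L[ℂ] H) (S z), C 3 (V t z)⟫_ℂ‖ ≤ c)
    (e : ℝ) {ψ : H} {η : ℝ} (hη : ∀ t, |t| ≤ α → ‖(U t : H →L[ℂ] H) ψ - ψ‖ ≤ η)
    {ε : ℝ} (hε : 0 < ε) :
    ∃ ζ, ‖S ζ - ψ‖ ≤ ‖S z - ψ‖ + η ∧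
      ‖⟪S ζ, C 1 ζ⟫_ℂ‖ ≤ Real.pi / α * (‖S z‖ * ‖C 0 z - (e : ℂ) • S z‖) + 2 * c * α ^ 2 + ε := by
  set φ := S z with hφ
  set ξ := C 0 z - (e : ℂ) • φ with hξ
  set cf : Fin 4 → ℝ → ℝ → ℂ := fun n s t => ⟪(U s : H →L[ℂ] H) φ, C n (V t z)⟫_ℂ with hcf
  have hU0 : ∀ x, (U 0 : H →L[ℂ] H) x = x := fun x => by rw [h0]; rfl
  have hV0 : V 0 z = z := h.injective (by rw [← hV, hU0])
  have hdiag : ∀ (n : Fin 3) u r,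
      HasDerivAt (fun r => cf n.castSucc (u + r) r) (cf n.succ (u + r) r) r := by
    intro n u r
    have h1 := hder n (u + r) r
    rw [← sub_self r] at h1
    have h2 := HasDerivAt.comp_sub_const r r h1
    refine h2.congr_of_eventuallyEq (Eventually.of_forall fun x => ?_)
    change _ = ⟪(U (u + r + (x - r)) : H →L[ℂ] H) φ, C n.castSucc (V (r + (x - r)) z)⟫_ℂ
    rw [show u + r + (x - r) = u + x by ring, show r + (x - r) = x by ring]
  obtain ⟨K, hK⟩ : ∃ K, ∀ t ∈ Set.Icc (-α) α, ‖cf 1 t t‖ ≤ K := by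
    refine isCompact_Icc.exists_bound_of_continuousOn (f := fun t => cf 1 t t) fun t _ => ?_
    have := (hdiag 1 0 t).continuousAt
    simp only [zero_add] at this
    exact this.continuousWithinAt
  have hK0 : 0 ≤ K := (norm_nonneg _).trans (hK 0 ⟨by linarith, hα.le⟩)
  obtain ⟨n, hn⟩ := exists_nat_gt (max 1 (K / ε))
  have hn1 : (1 : ℝ) < n := (le_max_left _ _).trans_lt hn
  have hnK : K < n * ε := by
    have := (le_max_right _ _).trans_lt hn
    rwa [div_lt_iff₀ hε] at this
  have hn0 : (0 : ℝ) < n := by linarith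
  set s := Finset.Icc (-n : ℤ) n with hs
  have hcard : (s.card : ℝ) = 2 * n + 1 := by
    have : s.card = 2 * n + 1 := by
      rw [hs, Int.card_Icc]; omega
    rw [this]; push_cast; ring
  set M : ℝ := (s.card : ℝ) with hM
  have hM0 : 0 < M := by rw [hcard]; positivity
  set τ : ℝ := α / n with hτ
  have hτ0 : 0 < τ := by positivity
  have htj : ∀ j ∈ s, |(j : ℝ) * τ| ≤ α := by
    intro j hj
    rw [hs, Finset.mem_Icc] at hj
    have : |(j : ℝ)| ≤ n := abs_le.mpr ⟨by exact_mod_cast hj.1, by exact_mod_cast hj.2⟩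
    rw [abs_mul, abs_of_pos hτ0, hτ, mul_div_assoc', div_le_iff₀ hn0, mul_comm]
    gcongr
  set ζ : H := (M : ℂ)⁻¹ • ∑ j ∈ s, V (j * τ) z with hζ
  have hSζ : S ζ = (M : ℂ)⁻¹ • ∑ j ∈ s, (U (j * τ) : H →L[ℂ] H) φ := by
    rw [hζ, map_smul, map_sum]
    simp only [hφ, hV]
  have hMc : (M : ℂ) ≠ 0 := by exact_mod_cast hM0.ne'
  refine ⟨ζ, ?_, ?_⟩
  · have e1 : S ζ - ψ = (M : ℂ)⁻¹ • ∑ j ∈ s, ((U (j * τ) : H →L[ℂ] H) φ - ψ) := by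
      rw [Finset.sum_sub_distrib, smul_sub, ← hSζ, Finset.sum_const, ← Nat.cast_smul_eq_nsmul ℂ,
        smul_smul]
      have : (M : ℂ) = (s.card : ℂ) := by rw [hM]; norm_cast
      rw [← this, inv_mul_cancel₀ hMc, one_smul]
    rw [e1, norm_smul, norm_inv, Complex.norm_real, Real.norm_of_nonneg hM0.le,
      inv_mul_le_iff₀ hM0]
    refine (norm_sum_le _ _).trans ?_
    have : ∀ j ∈ s, ‖(U (j * τ) : H →L[ℂ] H) φ - ψ‖ ≤ ‖φ - ψ‖ + η := by
      intro j hj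
      have e2 : (U (j * τ) : H →L[ℂ] H) φ - ψ
          = (U (j * τ) : H →L[ℂ] H) (φ - ψ) + ((U (j * τ) : H →L[ℂ] H) ψ - ψ) := by
        rw [map_sub]; abel
      rw [e2]
      refine (norm_add_le _ _).trans (add_le_add ?_ (hη _ (htj j hj)))
      rw [unitary_norm_map]
    refine (Finset.sum_le_card_nsmul s _ _ this).trans_eq ?_
    rw [nsmul_eq_mul]
  set q : ℤ → ℤ → ℂ := fun j k => cf 1 (j * τ) (k * τ) with hq
  have hform : ⟪S ζ, C 1 ζ⟫_ℂ = (M : ℂ)⁻¹ * ((M : ℂ)⁻¹ * ∑ j ∈ s, ∑ k ∈ s, q j k) := by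
    rw [hSζ, hζ, map_smul, map_sum, inner_smul_left, inner_smul_right, sum_inner]
    simp only [inner_sum, hq, hcf]
    congr 1
    rw [map_inv₀, Complex.conj_ofReal]
  -- Difference quotients along diagonals, with `τ⁻¹` taken out; on the main diagonal `0⁻¹ = 0`
  -- makes them zero.
  set r : ℤ → ℤ → ℂ := fun j k => ((j - k : ℤ) : ℂ)⁻¹ *
    (cf 0 (((j - k : ℤ) : ℝ) * τ) 0 - cf 0 0 (-(((j - k : ℤ) : ℝ) * τ))) with hr
  have hpt : ∀ j ∈ s, ∀ k ∈ s, ‖q j k + q (-k) (-j) - 2 * ((τ : ℂ)⁻¹ * r j k)‖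
      ≤ 4 * c * α ^ 2 + if j = k then 2 * K else 0 := by
    intro j hj k hk
    have tj := htj j hj
    have tk := htj k hk
    by_cases hjk : j = k
    · subst hjk
      have b1 : ‖q j j‖ ≤ K := hK _ (abs_le.mp tj)
      have b2 : ‖q (-j) (-j)‖ ≤ K := hK _ (abs_le.mp (by push_cast; rwa [neg_mul, abs_neg]))
      have hr0 : r j j = 0 := by simp [hr]
      rw [hr0, mul_zero, mul_zero, sub_zero, if_pos rfl]
      have : 0 ≤ 4 * c * α ^ 2 := by positivity
      refine (norm_add_le _ _).trans ?_
      linarith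
    · rw [if_neg hjk, add_zero]
      set u : ℝ := ((j - k : ℤ) : ℝ) * τ with hu
      have hjk' : ((j - k : ℤ) : ℝ) ≠ 0 := by exact_mod_cast sub_ne_zero.mpr hjk
      have hu' : u = j * τ - k * τ := by rw [hu]; push_cast; ring
      have hu2 : |u| ≤ 2 * α := by
        rw [hu']
        refine (abs_sub _ _).trans ?_
        linarith
      have hx : |(j * τ + k * τ) / 2| ≤ α := by
        rw [abs_div, abs_two, div_le_iff₀ two_pos]
        refine (abs_add_le _ _).trans ?_
        linarith
      have := norm_taylor_midpoint_le (hdiag 0 u) (hdiag 1 u) (hdiag 2 u) hc0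
        (fun r hr => hc (u + r) r hr) (mul_ne_zero hjk' hτ0.ne') hu2 hx
      refine le_of_eq_of_le ?_ this
      have a1 : -u / 2 + (j * τ + k * τ) / 2 = k * τ := by rw [hu']; ring
      have a2 : -u / 2 - (j * τ + k * τ) / 2 = -(j * τ) := by rw [hu']; ring
      rw [← hu, a1, a2, add_zero, add_neg_cancel]
      have a3 : u + k * τ = j * τ := by rw [hu']; ring
      have a4 : u + -(j * τ) = -(k * τ) := by rw [hu']; ring
      change ‖_‖ = ‖cf 1 (u + k * τ) (k * τ) + cf 1 (u + -(j * τ)) (-(j * τ))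
        - 2 * ((u : ℂ)⁻¹ * (cf 0 u 0 - cf 0 0 (-u)))‖
      rw [a3, a4]
      congr 2
      · simp only [hq]
        push_cast
        simp only [neg_mul]
      · simp only [hr]
        have hui : (u : ℂ)⁻¹ = (τ : ℂ)⁻¹ * ((j - k : ℤ) : ℂ)⁻¹ := by
          rw [hu, Complex.ofReal_mul, mul_inv_rev, Complex.ofReal_intCast]
        rw [← hu, hui]
        ring
  -- After writing `C 0 z = e φ + ξ` the terms with `e` cancel. Two Hilbert transforms remain, for
  -- `U τ` and its inverse.
  have hR : ‖∑ j ∈ s, ∑ k ∈ s, r j k‖ ≤ 2 * (Real.pi * M * (‖φ‖ * ‖ξ‖)) := by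
    have hre : ∀ j k, r j k
        = ((j - k : ℤ) : ℂ)⁻¹ * (starRingEnd ℂ) ⟪ξ, ((U τ ^ (j - k) : unitary (H →L[ℂ] H)) : H →L[ℂ] H) φ⟫_ℂ
          - ((j - k : ℤ) : ℂ)⁻¹ *
            ⟪ξ, (((U τ)⁻¹ ^ (j - k) : unitary (H →L[ℂ] H)) : H →L[ℂ] H) φ⟫_ℂ := by
      intro j k
      set u : ℝ := ((j - k : ℤ) : ℝ) * τ with hu
      have hW : U τ ^ (j - k) = U u := (unitary_group_int_mul h0 hadd τ _).symm
      have hW' : (U τ)⁻¹ ^ (j - k) = U (-u) := by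
        rw [inv_zpow, hW, unitary_group_neg h0 hadd]
      have b1 : cf 0 u 0 = e * ⟪(U u : H →L[ℂ] H) φ, φ⟫_ℂ + ⟪(U u : H →L[ℂ] H) φ, ξ⟫_ℂ := by
        simp only [hcf]
        rw [hV0, hξ, inner_sub_right, inner_smul_right]; ring
      have b2 : cf 0 0 (-u) = e * ⟪φ, (U (-u) : H →L[ℂ] H) φ⟫_ℂ
          + ⟪ξ, (U (-u) : H →L[ℂ] H) φ⟫_ℂ := by
        simp only [hcf]
        rw [hU0, hφ, ← hsym, hξ, inner_sub_left, inner_smul_left, hV, Complex.conj_ofReal]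
        ring
      have b3 : ⟪(U u : H →L[ℂ] H) φ, φ⟫_ℂ = ⟪φ, (U (-u) : H →L[ℂ] H) φ⟫_ℂ := by
        rw [← unitary_inner_map (U (-u)) ((U u : H →L[ℂ] H) φ)]
        congr 1
        have : (U (-u) : H →L[ℂ] H) ((U u : H →L[ℂ] H) φ) = (U (-u + u) : H →L[ℂ] H) φ := by
          rw [hadd]; rfl
        rw [this, neg_add_cancel, hU0]
      rw [hW, hW', inner_conj_symm]
      simp only [hr]
      rw [← hu, b1, b2, b3]
      ring
    simp only [hre, Finset.sum_sub_distrib]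
    refine (norm_sub_le _ _).trans ?_
    rw [two_mul]
    refine add_le_add ?_ (norm_sum_inner_unitary_le s _ φ ξ)
    refine le_of_eq_of_le ?_ (norm_sum_inner_unitary_le s (U τ) φ ξ)
    rw [← RCLike.norm_conj]
    congr 1
    simp only [map_sum, map_mul, map_inv₀, Complex.conj_conj, map_intCast]
  have hsum : ‖2 * ∑ j ∈ s, ∑ k ∈ s, q j k - 2 * ((τ : ℂ)⁻¹ * ∑ j ∈ s, ∑ k ∈ s, r j k)‖
      ≤ M * (M * (4 * c * α ^ 2)) + M * (2 * K) := by
    rw [two_mul_double_sum, ← hs]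
    simp only [Finset.mul_sum, ← Finset.sum_sub_distrib]
    refine (norm_sum_le_of_le s fun j hj => norm_sum_le_of_le s fun k hk => hpt j hj k hk).trans_eq ?_
    simp only [Finset.sum_add_distrib, Finset.sum_const, nsmul_eq_mul, Finset.sum_ite_eq]
    rw [Finset.sum_congr rfl (g := fun _ => 2 * K) fun j hj => if_pos hj]
    simp [hM]
  set Q := ∑ j ∈ s, ∑ k ∈ s, q j k
  set R := ∑ j ∈ s, ∑ k ∈ s, r j k
  have hQ : 2 * ‖Q‖ ≤ M * (M * (4 * c * α ^ 2)) + M * (2 * K)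
      + 2 * (τ⁻¹ * (2 * (Real.pi * M * (‖φ‖ * ‖ξ‖)))) := by
    have e1 : ‖2 * Q‖ = 2 * ‖Q‖ := by rw [norm_mul, Complex.norm_ofNat]
    have e2 : ‖2 * ((τ : ℂ)⁻¹ * R)‖ = 2 * (τ⁻¹ * ‖R‖) := by
      rw [norm_mul, Complex.norm_ofNat, norm_mul, norm_inv, Complex.norm_real,
        Real.norm_of_nonneg hτ0.le]
    have e3 := norm_le_norm_add_norm_sub' (2 * Q) (2 * ((τ : ℂ)⁻¹ * R))
    rw [e1, e2] at e3
    have : 2 * (τ⁻¹ * ‖R‖) ≤ 2 * (τ⁻¹ * (2 * (Real.pi * M * (‖φ‖ * ‖ξ‖)))) := by gcongr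
    linarith
  have hτM : 2 * τ⁻¹ ≤ M / α := by
    rw [hτ, inv_div, hcard, le_div_iff₀ hα]
    field_simp
    linarith
  rw [hform, norm_mul, norm_mul, norm_inv, Complex.norm_real, Real.norm_of_nonneg hM0.le,
    inv_mul_le_iff₀ hM0, inv_mul_le_iff₀ hM0]
  have hb : 0 ≤ Real.pi * M * (‖φ‖ * ‖ξ‖) := by positivity
  have h1 : 2 * τ⁻¹ * (Real.pi * M * (‖φ‖ * ‖ξ‖)) ≤ M / α * (Real.pi * M * (‖φ‖ * ‖ξ‖)) := by
    gcongr
  have h2 : M * K ≤ M * (M * ε) := by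
    gcongr
    rw [hcard]
    nlinarith
  have h3 : M / α * (Real.pi * M * (‖φ‖ * ‖ξ‖)) = M * (M * (Real.pi / α * (‖φ‖ * ‖ξ‖))) := by ring
  nlinarith

end Average
/-! ### The square root of an operator with a spectral measure -/

namespace ProjMeasure

variable (E : ProjMeasure H)

lemma inner_proj {s : Set ℝ} (hs : MeasurableSet s) (x y : H) :
    ⟪E.proj s x, y⟫_ℂ = ⟪x, E.proj s y⟫_ℂ := by
  have h := ContinuousLinearMap.adjoint_inner_left (E.proj s) y x
  rwa [← ContinuousLinearMap.star_eq_adjoint,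
    (E.isStarProjection s hs).isSelfAdjoint.star_eq] at h

lemma proj_proj {s t : Set ℝ} (hs : MeasurableSet s) (ht : MeasurableSet t) (x : H) :
    E.proj s (E.proj t x) = E.proj (s ∩ t) x := by
  rw [E.inter s t hs ht]; rfl

lemma norm_proj_le {s : Set ℝ} (hs : MeasurableSet s) (x : H) : ‖E.proj s x‖ ≤ ‖x‖ := by
  have h1 : ⟪E.proj s x, E.proj s x⟫_ℂ = ⟪x, E.proj s x⟫_ℂ := by
    rw [E.inner_proj hs, E.proj_proj hs hs, Set.inter_self]
  have h2 : ‖E.proj s x‖ * ‖E.proj s x‖ ≤ ‖x‖ * ‖E.proj s x‖ := by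
    calc _ = ‖⟪E.proj s x, E.proj s x⟫_ℂ‖ := by
          rw [inner_self_eq_norm_sq_to_K, norm_pow, RCLike.norm_ofReal, abs_norm, sq]
      _ ≤ _ := by rw [h1]; exact norm_inner_le_norm _ _
  rcases (norm_nonneg (E.proj s x)).eq_or_lt with h0 | h0
  · rw [← h0]; exact norm_nonneg _
  · exact le_of_mul_le_mul_right h2 h0

lemma scalar_apply {s : Set ℝ} (hs : MeasurableSet s) (x : H) :
    E.scalar x s = ENNReal.ofReal (⟪x, E.proj s x⟫_ℂ).re :=
  Measure.ofMeasurable_apply s hs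

instance (x : H) : IsFiniteMeasure (E.scalar x) :=
  ⟨by rw [E.scalar_apply MeasurableSet.univ]; exact ENNReal.ofReal_lt_top⟩

lemma scalar_proj {s : Set ℝ} (hs : MeasurableSet s) (x : H) :
    E.scalar (E.proj s x) = (E.scalar x).restrict s := by
  ext t ht
  rw [Measure.restrict_apply ht, E.scalar_apply ht, E.scalar_apply (ht.inter hs), E.inner_proj hs,
    E.proj_proj ht hs, E.proj_proj hs (ht.inter hs),
    Set.inter_eq_right.mpr Set.inter_subset_right]

lemma proj_add_proj_compl {s : Set ℝ} (hs : MeasurableSet s) (x : H) :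
    E.proj s x + E.proj sᶜ x = x := by
  have h := E.hasSum (fun n => if n = 0 then s else if n = 1 then sᶜ else ∅)
    (fun n => by
      split_ifs
      exacts [hs, hs.compl, MeasurableSet.empty])
    (fun m n hmn => by
      simp only [Function.onFun]
      split_ifs <;> simp_all [disjoint_compl_right, disjoint_compl_left]) x
  have hu : (⋃ n : ℕ, (if n = 0 then s else if n = 1 then sᶜ else ∅)) = Set.univ := by
    rw [Set.eq_univ_iff_forall]
    intro y
    by_cases hy : y ∈ s
    · exact Set.mem_iUnion.mpr ⟨0, by simpa using hy⟩
    · exact Set.mem_iUnion.mpr ⟨1, by simpa using hy⟩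
  rw [hu, E.univ] at h
  have h2 := hasSum_sum_of_ne_finset_zero (L := .unconditional ℕ) (f := fun n : ℕ =>
      E.proj (if n = 0 then s else if n = 1 then sᶜ else ∅) x) (s := Finset.range 2)
    (fun n hn => by
      have h1 : n ≠ 0 ∧ n ≠ 1 := by
        simp only [Finset.mem_range] at hn
        omega
      simp [h1.1, h1.2, E.proj_empty])
  have h3 := h2.unique h
  simpa [Finset.sum_range_succ] using h3.trans (show (1 : H →L[ℂ] H) x = x from rfl)

variable {E}

/-- The square of the left side is `∫ x` over the half-line `x ≥ 0`, which is `Re ⟪E([0,∞)) φ, A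
φ⟫`; then Cauchy-Schwarz. -/
lemma powNorm_half_sq_le {A : H →ₗ.[ℂ] H} (hE : E.IsSpectralMeasureOf A)
    (hA : ∀ x y : A.domain, ⟪A x, (y : H)⟫_ℂ = ⟪(x : H), A y⟫_ℂ) (φ : A.domain) :
    E.powNorm (1 / 2) (φ : H) ≤ √(‖(φ : H)‖ * ‖A φ‖) := by
  refine Real.sqrt_le_sqrt ?_
  set s : Set ℝ := Set.Ici 0
  have hs : MeasurableSet s := measurableSet_Ici
  have hint2 := (hE.1 φ).mp φ.2
  have hint : Integrable (fun x : ℝ => x) (E.scalar (φ : H)) := by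
    refine Integrable.mono' (hint2.add (integrable_const 1)) (by fun_prop) ?_
    refine Eventually.of_forall fun x => ?_
    simp only [Pi.add_apply, Real.norm_eq_abs]
    rw [← sq_abs]
    nlinarith [sq_nonneg (|x| - 1), abs_nonneg x]
  have hdom : ∀ t, MeasurableSet t → E.proj t (φ : H) ∈ A.domain := fun t ht => by
    rw [hE.1, E.scalar_proj ht]
    exact hint2.restrict
  set u : A.domain := ⟨E.proj s (φ : H), hdom s hs⟩ with hu
  set v : A.domain := ⟨E.proj sᶜ (φ : H), hdom _ hs.compl⟩ with hv
  have huv : u + v = φ := Subtype.ext (E.proj_add_proj_compl hs (φ : H))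
  have h1 : ⟪(u : H), A u⟫_ℂ = ((∫ x in s, x ∂(E.scalar (φ : H)) : ℝ) : ℂ) := by
    rw [hE.2 u, hu, E.scalar_proj hs]
  have h2 : ⟪(v : H), A v⟫_ℂ = ((∫ x in sᶜ, x ∂(E.scalar (φ : H)) : ℝ) : ℂ) := by
    rw [hE.2 v, hv, E.scalar_proj hs.compl]
  have h3 : ⟪((u + v : A.domain) : H), A (u + v)⟫_ℂ = ⟪(u : H), A u⟫_ℂ + ⟪(v : H), A v⟫_ℂ := by
    have := hE.2 (u + v)
    rw [this, h1, h2, huv, ← Complex.ofReal_add, integral_add_compl hs hint]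
  -- Only the quadratic form of `A` is given by the measure; additivity of the integral over the two
  -- half-lines kills the real cross term.
  have h4 : (⟪(u : H), A v⟫_ℂ).re = 0 := by
    rw [A.map_add, Submodule.coe_add, inner_add_left, inner_add_right, inner_add_right,
      ← hA v u, ← inner_conj_symm (A v)] at h3
    have := congrArg Complex.re h3
    simp only [Complex.add_re, Complex.conj_re] at this
    linarith
  have h5 : ∫ x in s, x ∂(E.scalar (φ : H)) = (⟪(u : H), A φ⟫_ℂ).re := by
    have : A φ = A u + A v := by rw [← A.map_add, huv]
    rw [this, inner_add_right, Complex.add_re, h4, add_zero, h1, Complex.ofReal_re]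
  have h6 : ∫ x, (x ^ (1 / 2 : ℝ)) ^ 2 ∂(E.scalar (φ : H)) = ∫ x in s, x ∂(E.scalar (φ : H)) := by
    rw [← integral_indicator hs]
    refine integral_congr_ae (Eventually.of_forall fun x => ?_)
    dsimp only
    by_cases hx : 0 ≤ x
    · rw [Set.indicator_of_mem (show x ∈ s from hx), ← Real.sqrt_eq_rpow, Real.sq_sqrt hx]
    -- For `x < 0` the real power `x ^ (1/2)` has the factor `cos (π/2) = 0`.
    · rw [Set.indicator_of_notMem (show x ∉ s from hx), Real.rpow_def_of_neg (not_le.mp hx)]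
      have : (1 / 2 : ℝ) * Real.pi = Real.pi / 2 := by ring
      rw [this, Real.cos_pi_div_two, mul_zero, zero_pow two_ne_zero]
  rw [h6, h5]
  refine (Complex.re_le_norm _).trans ((norm_inner_le_norm _ _).trans ?_)
  gcongr
  exact E.norm_proj_le hs _

end ProjMeasure
/-! ### Bounded realisations of operators on a common core -/

section Core

variable {𝒟 : Submodule ℂ H}

lemma exists_near_of_mem_graph_closure {f : H →ₗ.[ℂ] H} (hf : f.IsClosable) {φ y : H}
    (h : (φ, y) ∈ f.closure.graph) {η : ℝ} (hη : 0 < η) :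
    ∃ χ : f.domain, ‖(χ : H) - φ‖ < η ∧ ‖f χ - y‖ < η := by
  rw [← hf.graph_closure_eq_closure_graph] at h
  obtain ⟨⟨a, b⟩, hab, hd⟩ := Metric.mem_closure_iff.mp h η hη
  obtain ⟨χ, rfl, rfl⟩ := (LinearPMap.mem_graph_iff f).mp hab
  rw [Prod.dist_eq, max_lt_iff] at hd
  refine ⟨χ, ?_, ?_⟩
  · rw [← dist_eq_norm, dist_comm]; exact hd.1
  · rw [← dist_eq_norm, dist_comm]; exact hd.2

lemma isClosable_of_symmetricOn (hd : Dense (𝒟 : Set H)) {X : 𝒟 →ₗ[ℂ] H} (hX : SymmetricOn X) :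
    LinearPMap.IsClosable (⟨𝒟, X⟩ : H →ₗ.[ℂ] H) := by
  have h1 : LinearPMap.IsFormalAdjoint (⟨𝒟, X⟩ : H →ₗ.[ℂ] H) ⟨𝒟, X⟩ := fun x y => hX x y
  exact LinearPMap.isClosable_iff_exists_closed_extension.mpr
    ⟨_, LinearPMap.adjoint_isClosed (T := ⟨𝒟, X⟩) hd, h1.le_adjoint hd⟩

lemma exists_near_saExt (hd : Dense (𝒟 : Set H)) {X : 𝒟 →ₗ[ℂ] H} (hX : SymmetricOn X)
    (φ : (saExt X).domain) {η : ℝ} (hη : 0 < η) :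
    ∃ χ : 𝒟, ‖(χ : H) - φ‖ < η ∧ ‖X χ - saExt X φ‖ < η :=
  exists_near_of_mem_graph_closure (isClosable_of_symmetricOn hd hX)
    (LinearPMap.mem_graph (saExt X) φ) hη

lemma isClosed_saExt (hd : Dense (𝒟 : Set H)) {X : 𝒟 →ₗ[ℂ] H} (hX : SymmetricOn X) :
    (saExt X).IsClosed :=
  (isClosable_of_symmetricOn hd hX).closure_isClosed

lemma mem_graph_saExt (X : 𝒟 →ₗ[ℂ] H) (χ : 𝒟) : ((χ : H), X χ) ∈ (saExt X).graph :=
  LinearPMap.le_graph_of_le (LinearPMap.le_closure ⟨𝒟, X⟩)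
    (LinearPMap.mem_graph (⟨𝒟, X⟩ : H →ₗ.[ℂ] H) χ)

lemma exists_seq_saExt (hd : Dense (𝒟 : Set H)) {X : 𝒟 →ₗ[ℂ] H} (hX : SymmetricOn X)
    (φ : (saExt X).domain) : ∃ χ : ℕ → 𝒟, Tendsto (fun n => (χ n : H)) atTop (𝓝 (φ : H)) ∧
      Tendsto (fun n => X (χ n)) atTop (𝓝 (saExt X φ)) := by
  choose χ h1 h2 using fun n : ℕ =>
    exists_near_saExt hd hX φ (η := 1 / ((n : ℝ) + 1)) (by positivity)
  refine ⟨χ, ?_, ?_⟩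
  · exact tendsto_iff_norm_sub_tendsto_zero.mpr (squeeze_zero (fun _ => norm_nonneg _)
      (fun n => (h1 n).le) tendsto_one_div_add_atTop_nhds_zero_nat)
  · exact tendsto_iff_norm_sub_tendsto_zero.mpr (squeeze_zero (fun _ => norm_nonneg _)
      (fun n => (h2 n).le) tendsto_one_div_add_atTop_nhds_zero_nat)

lemma saExt_symm (hd : Dense (𝒟 : Set H)) {X : 𝒟 →ₗ[ℂ] H} (hX : SymmetricOn X)
    (φ ψ : (saExt X).domain) : ⟪saExt X φ, (ψ : H)⟫_ℂ = ⟪(φ : H), saExt X ψ⟫_ℂ := by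
  obtain ⟨χ, h1, h2⟩ := exists_seq_saExt hd hX φ
  obtain ⟨ξ, h3, h4⟩ := exists_seq_saExt hd hX ψ
  refine tendsto_nhds_unique (h2.inner (𝕜 := ℂ) h3) ((h1.inner (𝕜 := ℂ) h4).congr fun n => ?_)
  exact (hX _ _).symm

/-- The inverse of a selfadjoint operator `Λ ≥ 1`, with its square root. -/
lemma exists_scale {Λ : H →ₗ.[ℂ] H} (hΛ : IsSelfAdjoint Λ)
    (h1 : ∀ φ : Λ.domain, ‖(φ : H)‖ ^ 2 ≤ (⟪(φ : H), Λ φ⟫_ℂ).re) (hc : Λ.HasCore 𝒟) :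
    Dense (𝒟 : Set H) ∧ DenseRange (restrictTo Λ hc.le_domain) ∧
    ∃ S T : H →L[ℂ] H, IsScale S T ∧ (∀ χ : 𝒟, S (restrictTo Λ hc.le_domain χ) = χ) ∧
      (∀ z, (S z, z) ∈ Λ.graph) ∧ ∀ φ : Λ.domain, S (Λ φ) = φ := by
  set lam := restrictTo Λ hc.le_domain with hlam
  have hdd := hΛ.dense_domain
  have hcore : ∀ (φ : Λ.domain) (η : ℝ), 0 < η →
      ∃ χ : 𝒟, ‖(χ : H) - φ‖ < η ∧ ‖lam χ - Λ φ‖ < η := by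
    intro φ η hη
    have hcl : (Λ.domRestrict 𝒟).IsClosable :=
      hΛ.isClosed.isClosable.leIsClosable LinearPMap.domRestrict_le
    have hmem : ((φ : H), Λ φ) ∈ (Λ.domRestrict 𝒟).closure.graph := by
      rw [hc.closure_eq]
      exact LinearPMap.mem_graph Λ φ
    obtain ⟨χ, hχ1, hχ2⟩ := exists_near_of_mem_graph_closure hcl hmem hη
    refine ⟨⟨χ, χ.2.1⟩, hχ1, ?_⟩
    have : lam ⟨χ, χ.2.1⟩ = Λ.domRestrict 𝒟 χ :=
      (LinearPMap.domRestrict_apply (f := Λ) (x := χ) (y := ⟨χ, χ.2.2⟩) rfl).symm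
    rwa [this]
  have hsymm : ∀ φ ψ : Λ.domain, ⟪Λ φ, (ψ : H)⟫_ℂ = ⟪(φ : H), Λ ψ⟫_ℂ := by
    have := LinearPMap.adjoint_isFormalAdjoint hdd
    rw [LinearPMap.isSelfAdjoint_def.mp hΛ] at this
    exact this
  have hD : Dense (𝒟 : Set H) := by
    rw [Metric.dense_iff]
    intro x r hr
    obtain ⟨φ, hφ1, hφ2⟩ := Metric.dense_iff.mp hdd x (r / 2) (by positivity)
    obtain ⟨χ, hχ, -⟩ := hcore ⟨φ, hφ2⟩ (r / 2) (by positivity)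
    refine ⟨χ, ?_, χ.2⟩
    rw [Metric.mem_ball] at hφ1 ⊢
    rw [← dist_eq_norm] at hχ
    exact (dist_triangle _ φ _).trans_lt (by linarith)
  -- A vector orthogonal to the range lies in `D(Λ*) = D(Λ)` and satisfies `⟨y, Λ y⟩ = 0`, so `Λ ≥
  -- 1` forces it to vanish.
  have hR : DenseRange lam := by
    have : (LinearMap.range lam).topologicalClosure = ⊤ := by
      rw [Submodule.topologicalClosure_eq_top_iff, Submodule.eq_bot_iff]
      intro y hy
      rw [Submodule.mem_orthogonal] at hy
      have h2 : ∀ φ : Λ.domain, ⟪y, Λ φ⟫_ℂ = 0 := by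
        intro φ
        have : ∀ η > 0, ‖⟪y, Λ φ⟫_ℂ‖ ≤ ‖y‖ * η := by
          intro η hη
          obtain ⟨χ, -, hχ⟩ := hcore φ η hη
          have h3 : ⟪y, lam χ⟫_ℂ = 0 := by
            rw [← inner_conj_symm, hy _ ⟨χ, rfl⟩, map_zero]
          have h4 : ⟪y, Λ φ⟫_ℂ = -⟪y, lam χ - Λ φ⟫_ℂ := by
            rw [inner_sub_right, h3]; ring
          rw [h4, norm_neg]
          refine (norm_inner_le_norm _ _).trans ?_
          gcongr
        rw [← norm_le_zero_iff]
        refine le_of_forall_pos_le_add fun ε hε => ?_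
        have h5 := this (ε / (‖y‖ + 1)) (by positivity)
        refine h5.trans ?_
        rw [zero_add, mul_div_assoc', div_le_iff₀ (by positivity)]
        nlinarith [norm_nonneg y]
      have hmem : y ∈ Λ.adjoint.domain :=
        LinearPMap.mem_adjoint_domain_of_exists (T := Λ) y ⟨0, fun x => by
          rw [inner_zero_left, h2]⟩
      rw [LinearPMap.isSelfAdjoint_def.mp hΛ] at hmem
      have h3 := h1 ⟨y, hmem⟩
      rw [h2] at h3
      simpa using h3
    intro x
    have hx : x ∈ ((LinearMap.range lam).topologicalClosure : Set H) := by rw [this]; trivial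
    rw [Submodule.topologicalClosure_coe] at hx
    exact hx
  have hbound : ∀ φ : Λ.domain, ‖(φ : H)‖ ≤ ‖Λ φ‖ := by
    intro φ
    have h2 := h1 φ
    have h3 := (Complex.re_le_norm _).trans (norm_inner_le_norm (𝕜 := ℂ) (φ : H) (Λ φ))
    rcases (norm_nonneg (φ : H)).eq_or_lt with h0 | h0
    · rw [← h0]; exact norm_nonneg _
    · refine le_of_mul_le_mul_left ?_ h0
      nlinarith
  set S : H →L[ℂ] H := (𝒟.subtype).extendOfNorm lam with hS
  have hSl : ∀ χ : 𝒟, S (lam χ) = χ := fun χ =>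
    LinearMap.extendOfNorm_eq hR ⟨1, fun χ => by
      rw [one_mul]
      exact hbound ⟨χ, hc.le_domain χ.2⟩⟩ χ
  have hSg : ∀ z, (S z, z) ∈ Λ.graph := by
    intro z
    refine hR.induction_on (p := fun z => (S z, z) ∈ Λ.graph) z ?_ fun χ => ?_
    · exact hΛ.isClosed.preimage (f := fun z => (S z, z)) (by fun_prop)
    · rw [hSl]
      exact LinearPMap.mem_graph Λ ⟨χ, hc.le_domain χ.2⟩
  have hSΛ : ∀ φ : Λ.domain, S (Λ φ) = φ := by
    intro φ
    obtain ⟨w, hw1, hw2⟩ := (LinearPMap.mem_graph_iff Λ).mp (hSg (Λ φ))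
    have h2 := hbound (w - φ)
    rw [Λ.map_sub] at h2
    simp only at hw1 hw2
    rw [hw2, sub_self, norm_zero, norm_le_zero_iff] at h2
    rw [← hw1]
    simpa [sub_eq_zero] using h2
  have hSs : ∀ x y, ⟪S x, y⟫_ℂ = ⟪x, S y⟫_ℂ := by
    intro x y
    obtain ⟨v, hv1, hv2⟩ := (LinearPMap.mem_graph_iff Λ).mp (hSg x)
    obtain ⟨w, hw1, hw2⟩ := (LinearPMap.mem_graph_iff Λ).mp (hSg y)
    simp only at hv1 hv2 hw1 hw2
    rw [← hv1, ← hw1]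
    nth_rw 1 [← hw2]
    nth_rw 1 [← hv2]
    rw [hsymm]
  have hSp : ∀ x, ‖S x‖ ^ 2 ≤ (⟪S x, x⟫_ℂ).re := by
    intro x
    obtain ⟨v, hv1, hv2⟩ := (LinearPMap.mem_graph_iff Λ).mp (hSg x)
    simp only at hv1 hv2
    have := h1 v
    rwa [hv1, hv2] at this
  have hpos : 0 ≤ S := by
    rw [ContinuousLinearMap.nonneg_iff_isPositive, ContinuousLinearMap.isPositive_def]
    exact ⟨fun x y => hSs x y, fun x => (sq_nonneg _).trans (hSp x)⟩
  set T : H →L[ℂ] H := CFC.sqrt S with hT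
  have hTT : ∀ x, T (T x) = S x := fun x => by
    have := CFC.sqrt_mul_sqrt_self S hpos
    exact congrArg (fun F : H →L[ℂ] H => F x) this
  have hTs : ∀ x y, ⟪T x, y⟫_ℂ = ⟪x, T y⟫_ℂ := by
    have := CFC.sqrt_nonneg S
    rw [ContinuousLinearMap.nonneg_iff_isPositive, ContinuousLinearMap.isPositive_def] at this
    exact fun x y => this.1 x y
  refine ⟨hD, hR, S, T, ⟨hTs, hTT, fun x => ?_, ?_⟩, hSl, hSg, hSΛ⟩
  · refine le_of_sq_le_sq ?_ (norm_nonneg _)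
    have := hSp x
    rw [← hTT x, hTs] at this
    rw [← hTT x]
    exact this.trans_eq (inner_self_eq_norm_sq (𝕜 := ℂ) (T x))
  · have hr : Set.range S = Λ.domain := by
      ext y
      constructor
      · rintro ⟨z, rfl⟩
        obtain ⟨v, hv1, -⟩ := (LinearPMap.mem_graph_iff Λ).mp (hSg z)
        simp only at hv1
        rw [← hv1]
        exact v.2
      · intro hy
        exact ⟨Λ ⟨y, hy⟩, hSΛ ⟨y, hy⟩⟩
    rw [DenseRange, hr]
    exact hdd

/-- The bounded operator `X Λ⁻¹`. -/
lemma exists_gjnOp {lam : 𝒟 →ₗ[ℂ] H} (hR : DenseRange lam) (hd : Dense (𝒟 : Set H))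
    {S T : H →L[ℂ] H} (h : IsScale S T) (hS : ∀ χ : 𝒟, S (lam χ) = χ) {X : 𝒟 →ₗ[ℂ] H}
    (hX : SymmetricOn X) (hg : GJN X lam) :
    ∃ (Y : H →L[ℂ] H) (k : ℝ), GJNOp S T Y k ∧ (∀ χ : 𝒟, Y (lam χ) = X χ) ∧
      ∀ z, (S z, Y z) ∈ (saExt X).graph := by
  obtain ⟨k, hk⟩ := hg
  set Y : H →L[ℂ] H := X.extendOfNorm lam
  have hY : ∀ χ : 𝒟, Y (lam χ) = X χ :=
    fun χ => LinearMap.extendOfNorm_eq hR ⟨k, fun χ => (hk χ).1⟩ χ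
  refine ⟨Y, |k|, ⟨abs_nonneg k, ?_, ?_⟩, hY, ?_⟩
  · intro z y
    refine hR.induction_on₂ (p := fun z y => ⟪Y z, S y⟫_ℂ = ⟪S z, Y y⟫_ℂ) ?_ (fun a b => ?_) z y
    · exact isClosed_eq (by fun_prop) (by fun_prop)
    · simp only [hY, hS]
      exact hX a b
  · intro z
    refine hR.induction_on (p := fun z => |(⟪Y z, z⟫_ℂ).im| ≤ |k| / 2 * ‖T z‖ ^ 2) z ?_ fun χ => ?_
    · refine isClosed_le ?_ (by fun_prop)
      exact (Complex.continuous_im.comp (by fun_prop)).abs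
    · have h2 := (hk χ).2
      have h3 : ⟪(χ : H), lam χ⟫_ℂ = ((‖T (lam χ)‖ ^ 2 : ℝ) : ℂ) := by
        rw [← hS, h.inner_self_left]
      rw [h3, Complex.ofReal_re] at h2
      have h4 : (I * (⟪X χ, lam χ⟫_ℂ - ⟪lam χ, X χ⟫_ℂ)).re = -(2 * (⟪X χ, lam χ⟫_ℂ).im) := by
        rw [← inner_conj_symm (lam χ)]
        simp only [Complex.mul_re, Complex.I_re, Complex.I_im, Complex.sub_im, Complex.conj_im]
        ring
      rw [h4, abs_neg, abs_mul, abs_two] at h2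
      rw [hY]
      have : k * ‖T (lam χ)‖ ^ 2 ≤ |k| * ‖T (lam χ)‖ ^ 2 := by
        gcongr
        exact le_abs_self k
      linarith
  · intro z
    refine hR.induction_on (p := fun z => (S z, Y z) ∈ (saExt X).graph) z ?_ fun χ => ?_
    · exact (isClosed_saExt hd hX).preimage (f := fun z => (S z, Y z)) (by fun_prop)
    · rw [hS, hY]
      exact mem_graph_saExt X χ

end Core
/-! ### Existence of a virial family -/

section Family

variable {S T : H →L[ℂ] H} {U : ℝ → unitary (H →L[ℂ] H)} {V : ℝ → H →L[ℂ] H}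

/-- If approximate eigenvectors `φ` with `(L - e) φ = O(√ν)` and `N φ = O(1 / ν)` exist for all
small `ν`, then averaging over the unitary group makes the expectation of `C 1` small. -/
theorem exists_average_of_approx (h : IsScale S T) (h0 : U 0 = 1)
    (hadd : ∀ s t, U (s + t) = U s * U t)
    (hU : ∀ φ : H, Continuous fun t => (U t : H →L[ℂ] H) φ)
    (hV : ∀ t z, (U t : H →L[ℂ] H) (S z) = S (V t z)) {C : Fin 4 → H →L[ℂ] H} {N : H →L[ℂ] H}
    {R : Set H} (hR : Dense R)
    (hder : ∀ z ∈ R, ∀ (n : Fin 3) s t,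
      HasDerivAt (fun r => ⟪(U (s + r) : H →L[ℂ] H) (S z), C n.castSucc (V (t + r) z)⟫_ℂ)
        ⟪(U s : H →L[ℂ] H) (S z), C n.succ (V t z)⟫_ℂ 0)
    (hsym : ∀ a b, ⟪C 0 a, S b⟫_ℂ = ⟪S a, C 0 b⟫_ℂ) {k k' : ℝ} (hk : 0 ≤ k) (hk' : 0 ≤ k')
    (hC : ∀ t, ∀ z ∈ R, ‖C 3 (V t z)‖ ≤ k * Real.exp (k' * |t|) * √(‖S z‖ * ‖N z‖))
    {ψ : H} {e c : ℝ} (hc : 0 < c)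
    (happ : ∀ η > 0, ∃ ν₀ > 0, ∀ ν, 0 < ν → ν < ν₀ →
      ∃ z, ‖S z - ψ‖ < η ∧ ‖C 0 z - (e : ℂ) • S z‖ < c * √ν ∧ ‖N z‖ < c / ν)
    {η : ℝ} (hη : 0 < η) : ∃ ζ, ‖S ζ - ψ‖ < η ∧ ‖⟪S ζ, C 1 ζ⟫_ℂ‖ < η := by
  set B := ‖ψ‖ + 1 with hB
  have hB0 : 0 < B := by positivity
  set K := k * Real.exp (k' * 2) with hK
  have hK0 : 0 ≤ K := by positivity
  obtain ⟨ν₀, hν₀, happ⟩ := happ (min (η / 2) 1) (by positivity)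
  have hcont : ∀ᶠ t in 𝓝 (0 : ℝ), ‖(U t : H →L[ℂ] H) ψ - ψ‖ < η / 2 := by
    have h1 : Tendsto (fun t => ‖(U t : H →L[ℂ] H) ψ - ψ‖) (𝓝 0) (𝓝 ‖(U 0 : H →L[ℂ] H) ψ - ψ‖) :=
      (((hU ψ).sub continuous_const).norm).tendsto 0
    have h2 : (U 0 : H →L[ℂ] H) ψ = ψ := by rw [h0]; rfl
    rw [h2, sub_self, norm_zero] at h1
    exact h1.eventually_lt_const (by positivity)
  obtain ⟨α₁, hα₁, hcont⟩ := Metric.eventually_nhds_iff.mp hcont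
  have hsmall : ∀ (f : ℝ → ℝ) (b : ℝ), Continuous f → f 0 < b → ∀ᶠ β in 𝓝[>] (0 : ℝ), f β < b :=
    fun f b hf hb => nhdsWithin_le_nhds ((hf.tendsto 0).eventually_lt_const hb)
  obtain ⟨β, ⟨⟨⟨⟨hβ1, hβ2⟩, hβ3⟩, hβ4⟩, hβ5⟩, hβ⟩ :=
    ((((((hsmall (fun β => β ^ 2) α₁ (by fun_prop) (by simpa using hα₁)).and
      (hsmall (fun β => β ^ 6) ν₀ (by fun_prop) (by simpa using hν₀))).and
      (hsmall (fun β => β ^ 2) 1 (by fun_prop) (by simp))).and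
      (hsmall (fun β => Real.pi * B * c * β) (η / 4) (by fun_prop) (by simpa using hη))).and
      (hsmall (fun β => 2 * B * K * √(B * c) * β) (η / 4) (by fun_prop) (by simpa using hη))).and
      self_mem_nhdsWithin).exists
  have hβ0 : 0 < β := hβ
  -- With `ν = β⁶` and `α = β²`, both `√ν / α` and `α² / √ν` equal `β`.
  obtain ⟨z₀, hz₀⟩ := happ (β ^ 6) (by positivity) hβ2
  -- The bound on `C 3` is available only on `R`; the conditions on `z` are open, so `z` can be
  -- moved into this dense set.
  obtain ⟨z, ⟨hz1, hz2, hz3⟩, hzR⟩ := hR.inter_open_nonempty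
    {z | ‖S z - ψ‖ < min (η / 2) 1 ∧ ‖C 0 z - (e : ℂ) • S z‖ < c * √(β ^ 6) ∧ ‖N z‖ < c / β ^ 6}
    (by
      refine IsOpen.and ?_ (IsOpen.and ?_ ?_)
      · exact isOpen_lt (by fun_prop) (by fun_prop)
      · exact isOpen_lt (by fun_prop) (by fun_prop)
      · exact isOpen_lt (by fun_prop) (by fun_prop)) ⟨z₀, hz₀⟩
  have hsqrt : √(β ^ 6) = β ^ 3 := by
    rw [show β ^ 6 = (β ^ 3) ^ 2 by ring, Real.sqrt_sq (by positivity)]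
  rw [hsqrt] at hz2
  have hzB : ‖S z‖ ≤ B := by
    have h1 := norm_add_le (S z - ψ) ψ
    rw [sub_add_cancel] at h1
    have h2 := hz1.trans_le (min_le_right _ _)
    linarith
  have hNz : √(‖S z‖ * ‖N z‖) ≤ √(B * c) / β ^ 3 := by
    rw [← hsqrt, ← Real.sqrt_div' _ (by positivity)]
    refine Real.sqrt_le_sqrt ?_
    rw [mul_div_assoc]
    gcongr
  obtain ⟨ζ, hζ1, hζ2⟩ := exists_average h h0 hadd hV (hder z hzR) hsym (α := β ^ 2)
    (c := B * (K * (√(B * c) / β ^ 3))) (by positivity) (by positivity)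
    (fun s t ht => by
      refine (norm_inner_le_norm _ _).trans ?_
      rw [unitary_norm_map]
      refine mul_le_mul hzB ((hC t z hzR).trans ?_) (norm_nonneg _) hB0.le
      refine mul_le_mul ?_ hNz (Real.sqrt_nonneg _) hK0
      rw [hK]
      gcongr
      linarith)
    e (ψ := ψ) (η := η / 2)
    (fun t ht => (hcont (by rw [Real.dist_eq, sub_zero]; exact ht.trans_lt hβ1)).le)
    (show 0 < η / 4 by positivity)
  refine ⟨ζ, ?_, ?_⟩
  · have := hz1.trans_le (min_le_left _ _)
    linarith
  · have h1 : Real.pi / β ^ 2 * (‖S z‖ * ‖C 0 z - (e : ℂ) • S z‖) ≤ Real.pi * B * c * β := by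
      calc _ ≤ Real.pi / β ^ 2 * (B * (c * β ^ 3)) := by
            have := Real.pi_pos
            gcongr
        _ = _ := by field_simp
    have h2 : 2 * (B * (K * (√(B * c) / β ^ 3))) * (β ^ 2) ^ 2 = 2 * B * K * √(B * c) * β := by
      field_simp
    rw [h2] at hζ2
    linarith

lemma IsUnitaryGroupOf.map_mem_graph {A : H →ₗ.[ℂ] H} (hA : IsUnitaryGroupOf U A) (s : ℝ) {φ y : H}
    (h : (φ, y) ∈ A.graph) :
    ((U s : H →L[ℂ] H) φ, (U s : H →L[ℂ] H) y) ∈ A.graph := by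
  rw [hA.generator] at h ⊢
  have h1 := ((U s : H →L[ℂ] H).restrictScalars ℝ).hasFDerivAt.comp_hasDerivAt (0 : ℝ) h
  have h2 : ((U s : H →L[ℂ] H).restrictScalars ℝ) (I • y) = I • (U s : H →L[ℂ] H) y := by
    rw [ContinuousLinearMap.coe_restrictScalars', map_smul]
  rw [h2] at h1
  refine h1.congr_of_eventuallyEq (Eventually.of_forall fun t => ?_)
  change (U t : H →L[ℂ] H) ((U s : H →L[ℂ] H) φ) = (U s : H →L[ℂ] H) ((U t : H →L[ℂ] H) φ)
  have h3 : U t * U s = U s * U t := by rw [← hA.map_add, ← hA.map_add, add_comm]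
  exact congrArg (fun W : unitary (H →L[ℂ] H) => (W : H →L[ℂ] H) φ) h3

variable {𝒟 : Submodule ℂ H}

/-- A form commutator on `𝒟` extends to the closure of the graph of the pair. -/
lemma IsFormCommutator.inner_eq_of_mem_closure {X Y Z lam : 𝒟 →ₗ[ℂ] H}
    (hZ : IsFormCommutator Z X Y) {X' Z' : H →L[ℂ] H} (hX' : ∀ χ, X' (lam χ) = X χ)
    (hZ' : ∀ χ, Z' (lam χ) = Z χ) (hS : ∀ χ : 𝒟, S (lam χ) = χ) {a b p q : H}
    (ha : (a, p) ∈ closure (Set.range fun χ => (lam χ, Y χ)))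
    (hb : (b, q) ∈ closure (Set.range fun χ => (lam χ, Y χ))) :
    ⟪S a, Z' b⟫_ℂ = I * (⟪X' a, q⟫_ℂ - ⟪p, X' b⟫_ℂ) := by
  have hcl : IsClosed {u : (H × H) × H × H |
      ⟪S u.1.1, Z' u.2.1⟫_ℂ = I * (⟪X' u.1.1, u.2.2⟫_ℂ - ⟪u.1.2, X' u.2.1⟫_ℂ)} :=
    isClosed_eq (by fun_prop) (by fun_prop)
  have hsub : (Set.range fun χ => (lam χ, Y χ)) ×ˢ (Set.range fun χ => (lam χ, Y χ)) ⊆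
      {u : (H × H) × H × H |
        ⟪S u.1.1, Z' u.2.1⟫_ℂ = I * (⟪X' u.1.1, u.2.2⟫_ℂ - ⟪u.1.2, X' u.2.1⟫_ℂ)} := by
    rintro ⟨_, _⟩ ⟨⟨φ, rfl⟩, ⟨χ, rfl⟩⟩
    simp only [Set.mem_ofPred_eq, hS, hX', hZ']
    exact hZ φ χ
  have hmem : ((a, p), (b, q)) ∈ closure
      ((Set.range fun χ => (lam χ, Y χ)) ×ˢ (Set.range fun χ => (lam χ, Y χ))) := by
    rw [closure_prod_eq]
    exact ⟨ha, hb⟩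
  exact hcl.closure_subset_iff.mpr hsub hmem

end Family

/-! ### From the abstract setting to the bounded operators -/

section Setting

variable {𝒟 : Submodule ℂ H} {Λ A : H →ₗ.[ℂ] H} {U : ℝ → unitary (H →L[ℂ] H)}
  {L N D : 𝒟 →ₗ[ℂ] H} {C : Fin 4 → 𝒟 →ₗ[ℂ] H} {E : ProjMeasure H}

lemma Setting.dense (hS : Setting 𝒟 Λ A U L N D C E) : Dense (𝒟 : Set H) :=
  (exists_scale hS.Λ_selfAdjoint hS.one_le_Λ hS.Λ_core).1

lemma saExt_apply (X : 𝒟 →ₗ[ℂ] H) (χ : 𝒟) (hχ : (χ : H) ∈ (saExt X).domain) :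
    saExt X ⟨χ, hχ⟩ = X χ :=
  (LinearPMap.mem_graph_snd_inj _ (LinearPMap.mem_graph (saExt X) ⟨χ, hχ⟩) (mem_graph_saExt X χ) rfl)

lemma Setting.powNorm_half_le (hS : Setting 𝒟 Λ A U L N D C E) (χ : 𝒟) :
    E.powNorm (1 / 2) (χ : H) ≤ √(‖(χ : H)‖ * ‖N χ‖) := by
  have hχ : (χ : H) ∈ (saExt N).domain := LinearPMap.mem_domain_of_mem_graph (mem_graph_saExt N χ)
  have := ProjMeasure.powNorm_half_sq_le hS.E_spectral (saExt_symm hS.dense hS.N_symm) ⟨χ, hχ⟩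
  rwa [saExt_apply] at this

lemma eigenvalue_real {B : H →ₗ.[ℂ] H} (hB : ∀ x y : B.domain, ⟪B x, (y : H)⟫_ℂ = ⟪(x : H), B y⟫_ℂ)
    {ψ : B.domain} (hψ : (ψ : H) ≠ 0) {e : ℂ} (hev : B ψ = e • (ψ : H)) : ∃ r : ℝ, e = (r : ℂ) := by
  have h := hB ψ ψ
  rw [hev, inner_smul_left, inner_smul_right] at h
  exact ⟨e.re, (Complex.conj_eq_iff_re.mp
    (mul_right_cancel₀ (inner_self_ne_zero.mpr hψ) h)).symm⟩

/-- Near every eigenvector of `L` there are vectors in `D(L) ∩ D(C₁)` with small expectation of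
`C₁`. -/
theorem Setting.exists_near_eigenvector (hS : Setting 𝒟 Λ A U L N D C E)
    (hB : RelativeBounds U E D C) (ψ : (saExt L).domain) {e : ℝ}
    (hev : saExt L ψ = (e : ℂ) • (ψ : H)) {η : ℝ} (hη : 0 < η) :
    ∃ x ∈ (saExt L).domain, ∃ y, (x, y) ∈ (saExt (C 1)).graph ∧ ‖x - ψ‖ < η ∧ ‖⟪x, y⟫_ℂ‖ < η := by
  obtain ⟨hd, hR, S, T, h, hSl, hSg, hSΛ⟩ := exists_scale hS.Λ_selfAdjoint hS.one_le_Λ hS.Λ_core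
  set lam := restrictTo Λ hS.Λ_core.le_domain with hlam
  obtain ⟨N', kN, hN, hN', -⟩ := exists_gjnOp hR hd h hSl hS.N_symm hS.N_gjn
  obtain ⟨D', kD, -, hD', -⟩ := exists_gjnOp hR hd h hSl hS.D_symm hS.D_gjn
  choose C' kC hC hC' hCg using fun n => exists_gjnOp hR hd h hSl (hS.C_symm n) (hS.C_gjn n)
  obtain ⟨k, k', p, hk, hk', -, hB1, -, hB3⟩ := hB
  have h0 := hS.U_exp.map_zero
  have hadd := hS.U_exp.map_add
  have hVex : ∀ t, ∃ V : H →L[ℂ] H, ∀ z, (U t : H →L[ℂ] H) (S z) = S (V z) := fun t =>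
    exists_conj_of_invariant h fun z => ⟨_, (hSΛ ⟨_, hS.U_invariant t (S z)
      (LinearPMap.mem_domain_of_mem_graph (hSg z))⟩).symm⟩
  choose V hV using hVex
  have hC0 : ∀ χ, C' 0 (lam χ) = L χ := fun χ => by rw [hC', hS.C_zero]
  obtain ⟨c, hc, happ⟩ := exists_regular_approx_eigenvector h hN (hC 0) hk (D := D') (ψ := ψ) (e := e)
    (fun z => hR.induction_on (p := fun z => ‖D' z‖ ≤ k * √(‖S z‖ * ‖N' z‖)) z
      (isClosed_le (by fun_prop) (by fun_prop)) fun χ => by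
        rw [hD', hSl, hN']
        exact (hB1 χ).2.trans (by gcongr; exact hS.powNorm_half_le χ))
    (fun z a => hR.induction_on₂
      (p := fun z a => ⟪S z, D' a⟫_ℂ = I * (⟪C' 0 z, N' a⟫_ℂ - ⟪N' z, C' 0 a⟫_ℂ))
      (isClosed_eq (by fun_prop) (by fun_prop)) (fun φ χ => by
        rw [hSl, hD', hC0, hC0, hN', hN']
        exact hS.D_eq φ χ) z a)
    (fun ε hε => by
      obtain ⟨χ, h1, h2⟩ := exists_near_saExt hd hS.L_symm ψ (η := ε / (2 * (|e| + 1)))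
        (by positivity)
      have h3 : ε / (2 * (|e| + 1)) * (2 * (|e| + 1)) = ε := by field_simp
      have h4 : 0 < ε / (2 * (|e| + 1)) := by positivity
      refine ⟨lam χ, ?_, ?_⟩
      · rw [hSl]
        nlinarith [abs_nonneg e]
      · rw [hSl, hC0]
        rw [hev] at h2
        have h5 : L χ - (e : ℂ) • (χ : H)
            = (L χ - (e : ℂ) • (ψ : H)) - (e : ℂ) • ((χ : H) - ψ) := by
          rw [smul_sub]; abel
        rw [h5]
        refine (norm_sub_le _ _).trans_lt ?_
        rw [norm_smul, Complex.norm_real, Real.norm_eq_abs]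
        nlinarith [abs_nonneg e, mul_le_mul_of_nonneg_left h1.le (abs_nonneg e)])
  -- The group maps `𝒟` into `D(Λ) ∩ D(A)` but perhaps not into `𝒟`; joint density carries the form
  -- commutators with `A` over to the translated vectors.
  have hcore : ∀ z y, (S z, y) ∈ A.graph →
      (z, y) ∈ closure (Set.range fun χ => (lam χ, restrictTo A hS.le_A χ)) := by
    intro z y hy
    rw [Metric.mem_closure_iff]
    intro ε hε
    obtain ⟨χ, hχ⟩ := hS.joint_core (S z) (LinearPMap.mem_domain_of_mem_graph (hSg z))
      (LinearPMap.mem_domain_of_mem_graph hy) ε hε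
    have e1 : Λ ⟨S z, LinearPMap.mem_domain_of_mem_graph (hSg z)⟩ = z :=
      LinearPMap.mem_graph_snd_inj _ (LinearPMap.mem_graph Λ _) (hSg z) rfl
    have e2 : A ⟨S z, LinearPMap.mem_domain_of_mem_graph hy⟩ = y :=
      LinearPMap.mem_graph_snd_inj _ (LinearPMap.mem_graph A _) hy rfl
    rw [e1, e2] at hχ
    refine ⟨_, ⟨χ, rfl⟩, ?_⟩
    rw [Prod.dist_eq, dist_eq_norm, dist_eq_norm]
    refine max_lt ?_ ?_
    · exact (le_add_of_nonneg_right (norm_nonneg _)).trans_lt hχ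
    · exact (le_add_of_nonneg_left (norm_nonneg _)).trans_lt hχ
  obtain ⟨ζ, hζ1, hζ2⟩ := exists_average_of_approx h h0 hadd hS.U_exp.continuous hV (C := C') (N := N')
    (R := Set.range lam) hR
    (by
      rintro _ ⟨χ, rfl⟩ n s t
      have hg : ∀ r, (S (V r (lam χ)), (U r : H →L[ℂ] H) (restrictTo A hS.le_A χ)) ∈ A.graph := by
        intro r
        rw [← hV, hSl]
        exact hS.U_exp.map_mem_graph r (LinearPMap.mem_graph A ⟨χ, hS.le_A χ.2⟩)
      have hder := hasDerivAt_inner_conj h h0 hadd hS.U_exp.continuous hV (hC n.castSucc).symm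
        ((hS.U_exp.generator _ _).mp (hg s)) ((hS.U_exp.generator _ _).mp (hg t))
        (Y := C' n.succ) ((hS.C_succ n).inner_eq_of_mem_closure (hC' _) (hC' _) hSl
          (hcore _ _ (hg s)) (hcore _ _ (hg t)))
      rw [hV s]
      refine hder.congr_of_eventuallyEq (Eventually.of_forall fun r => ?_)
      dsimp only
      rw [add_comm t r, conj_add h hadd hV, add_comm s r, hadd, ← hV s]
      rfl)
    (hC 0).symm hk hk'
    (by
      rintro t _ ⟨χ, rfl⟩
      have h1 := hCg 3 (V t (lam χ))
      rw [← hV, hSl] at h1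
      -- Taken at `-t`, since the outer unitary drops out of `‖e^{-itA} C₃ e^{itA} χ‖`.
      have h2 := (hB3 (-t) χ).2 (by rw [neg_neg]; exact LinearPMap.mem_domain_of_mem_graph h1)
      rw [unitary_norm_map, abs_neg, LinearPMap.mem_graph_snd_inj _
        (LinearPMap.mem_graph (saExt (C 3)) _) h1 (by simp only [neg_neg])] at h2
      rw [hSl, hN']
      exact h2.trans (by gcongr; exact hS.powNorm_half_le χ))
    hc happ hη
  have hgL := hCg 0 ζ
  rw [hS.C_zero] at hgL
  exact ⟨S ζ, LinearPMap.mem_domain_of_mem_graph hgL, C' 1 ζ, hCg 1 ζ, hζ1, hζ2⟩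

end Setting
/-! ### The commutator with a bounded operator -/

section Bounded

variable {𝒟 : Submodule ℂ H}

lemma commutator_domain {B : H →ₗ.[ℂ] H} {A₀ : H →L[ℂ] H} (hA₀ : ∀ φ, A₀ φ ∈ B.domain) :
    (commutator B A₀).domain = B.domain :=
  inf_eq_left.mpr fun φ _ => hA₀ φ

/-- If a closed operator is defined on the range of a bounded operator, then the product is
bounded. -/
lemma exists_comp_of_isClosed {B : H →ₗ.[ℂ] H} (hB : B.IsClosed) {A₀ : H →L[ℂ] H}
    (hA₀ : ∀ φ, A₀ φ ∈ B.domain) : ∃ F : H →L[ℂ] H, ∀ φ, F φ = B ⟨A₀ φ, hA₀ φ⟩ := by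
  let F : H →ₗ[ℂ] H := B.toFun ∘ₗ (A₀ : H →ₗ[ℂ] H).codRestrict B.domain hA₀
  refine ⟨⟨F, F.continuous_of_seq_closed_graph fun u x y hu hF => ?_⟩, fun φ => rfl⟩
  have h1 : (A₀ x, y) ∈ B.graph := by
    refine hB.mem_of_tendsto (((A₀.continuous.tendsto x).comp hu).prodMk_nhds hF)
      (Eventually.of_forall fun n => ?_)
    exact LinearPMap.mem_graph B ⟨A₀ (u n), hA₀ (u n)⟩
  exact LinearPMap.mem_graph_snd_inj _ h1 (LinearPMap.mem_graph B ⟨A₀ x, hA₀ x⟩) rfl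

/-- The virial theorem for the commutator with a bounded operator. -/
lemma tendsto_inner_commutator {B : H →ₗ.[ℂ] H} (hB : B.IsClosed)
    (hs : ∀ x y : B.domain, ⟪B x, (y : H)⟫_ℂ = ⟪(x : H), B y⟫_ℂ) {A₀ : H →L[ℂ] H}
    (hsa : IsSelfAdjoint A₀) (hA₀ : ∀ φ, A₀ φ ∈ B.domain) (ψ : B.domain) {e : ℝ}
    (hev : B ψ = (e : ℂ) • (ψ : H)) {ι : Type*} {l : Filter ι} {u : ι → H}
    (hu : Tendsto u l (𝓝 (ψ : H))) (hmem : ∀ i, u i ∈ (commutator B A₀).domain) :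
    Tendsto (fun i => ⟪u i, commutator B A₀ ⟨u i, hmem i⟩⟫_ℂ) l (𝓝 0) := by
  obtain ⟨F, hF⟩ := exists_comp_of_isClosed hB hA₀
  have hA : ∀ x y, ⟪A₀ x, y⟫_ℂ = ⟪x, A₀ y⟫_ℂ := fun x y => by
    have := ContinuousLinearMap.adjoint_inner_left A₀ y x
    rwa [← ContinuousLinearMap.star_eq_adjoint, hsa.star_eq] at this
  have h1 : ∀ x : B.domain, ⟪(x : H), A₀ (B x)⟫_ℂ = ⟪F x, (x : H)⟫_ℂ := fun x => by
    rw [← hA, hF]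
    exact (hs ⟨A₀ x, hA₀ x⟩ x).symm
  -- Only the bounded operator `F = L A₀` survives, so convergence in norm suffices and nothing is
  -- asked of `L (u i)`.
  have h2 : ∀ i, ⟪u i, commutator B A₀ ⟨u i, hmem i⟩⟫_ℂ = ⟪u i, F (u i)⟫_ℂ - ⟪F (u i), u i⟫_ℂ := by
    intro i
    rw [← h1 ⟨u i, (hmem i).1⟩, hF, ← inner_sub_right]
    rfl
  have h3 : Tendsto (fun i => F (u i)) l (𝓝 (F ψ)) := (F.continuous.tendsto _).comp hu
  have h4 : ⟪(ψ : H), F ψ⟫_ℂ - ⟪F ψ, (ψ : H)⟫_ℂ = 0 := by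
    rw [← h1 ψ, hF, ← hs ψ, hev, map_smul, inner_smul_left, inner_smul_right, Complex.conj_ofReal,
      sub_self]
  simp only [h2]
  rw [← h4]
  exact (hu.inner h3).sub (h3.inner hu)

end Bounded

/-! ### The virial family and the final statement -/

section Setting

variable {𝒟 : Submodule ℂ H} {Λ A : H →ₗ.[ℂ] H} {U : ℝ → unitary (H →L[ℂ] H)}
  {L N D : 𝒟 →ₗ[ℂ] H} {C : Fin 4 → 𝒟 →ₗ[ℂ] H} {E : ProjMeasure H}

/-- The first virial theorem. -/
theorem Setting.exists_isVirialFamily (hS : Setting 𝒟 Λ A U L N D C E)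
    (hB : RelativeBounds U E D C) (ψ : (saExt L).domain) {e : ℝ}
    (hev : saExt L ψ = (e : ℂ) • (ψ : H)) :
    ∃ ψα : Set.Ioi (0 : ℝ) → H, IsVirialFamily (saExt L) (saExt (C 1)) ψ ψα := by
  choose ψα hL y hy h1 h2 using fun α : Set.Ioi (0 : ℝ) =>
    hS.exists_near_eigenvector hB ψ hev (η := (α : ℝ)) α.2
  have hα : Tendsto (fun α : Set.Ioi (0 : ℝ) => (α : ℝ)) (comap Subtype.val (𝓝 0)) (𝓝 0) :=
    tendsto_comap
  refine ⟨ψα, hL, fun α => LinearPMap.mem_domain_of_mem_graph (hy α), ?_, ?_⟩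
  · exact tendsto_iff_norm_sub_tendsto_zero.mpr
      (squeeze_zero (fun _ => norm_nonneg _) (fun α => (h1 α).le) hα)
  · refine tendsto_zero_iff_norm_tendsto_zero.mpr
      (squeeze_zero (fun _ => norm_nonneg _) (fun α => ?_) hα)
    rw [LinearPMap.mem_graph_snd_inj _ (LinearPMap.mem_graph (saExt (C 1)) _) (hy α) rfl]
    exact (h2 α).le

end Setting

end Virial

end

theorem mainTheorem5 {H : Type*} [NormedAddCommGroup H] [InnerProductSpace ℂ H] [CompleteSpace H]
    (𝒟 : Submodule ℂ H) (Λ A : H →ₗ.[ℂ] H) (U : ℝ → unitary (H →L[ℂ] H))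
    (L N D : 𝒟 →ₗ[ℂ] H) (C : Fin 4 → 𝒟 →ₗ[ℂ] H) (E : Virial.ProjMeasure H)
    (hS : Virial.Setting 𝒟 Λ A U L N D C E)
    (hB : Virial.RelativeBounds U E D C)
    (ψ : (Virial.saExt L).domain) (hψ : (ψ : H) ≠ 0) (e : ℂ)
    (hev : Virial.saExt L ψ = e • (ψ : H)) :
    (∀ A₀ : H →L[ℂ] H, (∀ φ, A₀ φ ∈ (Virial.saExt L).domain) →
      (∃ n₀ : ℝ, ∀ φ, ∃ χ, A₀ φ = E.proj (Set.Iic n₀) χ) →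
        (Virial.commutator (Virial.saExt L) A₀).domain = (Virial.saExt L).domain) ∧
    (∃ ψα : Set.Ioi (0 : ℝ) → H,
      Virial.IsVirialFamily (Virial.saExt L) (Virial.saExt (C 1)) ψ ψα) ∧
    ∀ ψα : Set.Ioi (0 : ℝ) → H,
      Virial.IsVirialFamily (Virial.saExt L) (Virial.saExt (C 1)) ψ ψα →
      ∀ A₀ : H →L[ℂ] H, IsSelfAdjoint A₀ →
        (∀ φ, A₀ φ ∈ (Virial.saExt L).domain) →
        (∃ n₀ : ℝ, ∀ φ, ∃ χ, A₀ φ = E.proj (Set.Iic n₀) χ) →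
          ∃ hmem : ∀ α, ψα α ∈
              (Virial.saExt (C 1) + I • Virial.commutator (Virial.saExt L) A₀).domain,
            Tendsto (fun α => ⟪ψα α,
                (Virial.saExt (C 1) + I • Virial.commutator (Virial.saExt L) A₀)
                  ⟨ψα α, hmem α⟩⟫_ℂ)
              (comap Subtype.val (𝓝 0)) (𝓝 0) := by
  -- A real eigenvalue is needed for the cancellations both in the averaging and in the expectation
  -- of `[L, A₀]`.
  obtain ⟨r, rfl⟩ := Virial.eigenvalue_real (Virial.saExt_symm hS.dense hS.L_symm) hψ hev
  refine ⟨fun A₀ hA₀ _ => Virial.commutator_domain hA₀, hS.exists_isVirialFamily hB ψ hev,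
    fun ψα hψα A₀ hsa hA₀ _ => ?_⟩
  have hdom : ∀ α, ψα α ∈ (Virial.commutator (Virial.saExt L) A₀).domain := fun α => by
    rw [Virial.commutator_domain hA₀]
    exact hψα.mem_L α
  refine ⟨fun α => ⟨hψα.mem_C₁ α, hdom α⟩, ?_⟩
  have h1 := Virial.tendsto_inner_commutator (Virial.isClosed_saExt hS.dense hS.L_symm)
    (Virial.saExt_symm hS.dense hS.L_symm) hsa hA₀ ψ hev hψα.tendsto hdom
  have h2 := hψα.virial.add (h1.const_mul I)
  rw [mul_zero, add_zero] at h2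
  refine h2.congr fun α => ?_
  rw [← inner_smul_right, ← inner_add_right]
  rfl
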